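/- Let $\mathcal O_K$ be a complete discrete valuation ring with fraction field $K$ of characteristic $0$ and perfect residue field of characteristic $p>0$; let $\varpi$ be a uniformizer and $d\ge 0$ an integer. Let $\mathcal{BT}$ be the Bruhat–Tits building of $\mathrm{PGL}_{d+1}(K)$: its vertices are the homothety classes $[M]$ of $\mathcal O_K$-lattices $M\subset K^{d+1}$, and its simplices are the sets $\{[M_0],\dots,[M_k]\}$ with $\varpi M_k\subsetneq M_0\subsetneq M_1\subsetneq\cdots\subsetneq M_k$. Let $|\mathcal{BT}|$ be its topological realization, let $s_0=[\mathcal O_K^{d+1}]$, and let $\delta$ be the combinatorial distance on vertices (the length of a shortest path in the $1$-skeleton). Put $B(0)=\{s_0\}$ and, for $n\ge 1$, $$B(n)=\bigcup_{s\,:\,\delta(s_0,s)\le n-1}\overline{\mathrm{St}}(s)\subset|\mathcal{BT}|,\qquad \overline{\mathrm{St}}(s)=\bigcup_{\tau\ni s}|\tau|,$$ the second union being over the simplices $\tau$ having $s$ as a vertex. Each basis $(f_0,\dots,f_d)$ of $K^{d+1}$ defines an apartment, the union of the closed simplices all of whose vertices are of the form $[\bigoplus_i\varpi^{\alpha_i}\mathcal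 O_K f_i]$ with $\alpha\in\mathbb Z^{d+1}$; it is identified, affinely on each simplex, with the Euclidean space $\mathbb R^{d+1}/\mathbb R(1,\dots,1)$ (with the quotient of the standard Euclidean norm), the vertex $[\bigoplus_i\varpi^{\alpha_i}\mathcal O_K f_i]$ corresponding to the class of $\alpha$. Let $|\mathcal{BT}|$ carry the resulting distance: the distance of two points is their Euclidean distance in any apartment containing both. Then for every $n\ge 0$ the ball $B(n)$ is geodesically convex (also called geodesically contractible): for all $x,y\in B(n)$, every geodesic from $x$ to $y$ in $|\mathcal{BT}|$ is contained in $B(n)$. -/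

import Mathlib

open scoped Pointwise

namespace BruhatTits

noncomputable section

section Complex

variable (O K : Type*) [CommRing O] [Field K] [Algebra O K] (d : ℕ)

/-- The `O`-lattices of `K^{d+1}`: finitely generated `O`-submodules spanning `K^{d+1}` over `K`. -/
abbrev Lattice : Type _ :=
  {M : Submodule O (Fin (d + 1) → K) // Submodule.IsLattice K M}

/-- Two lattices are homothetic if they differ by a nonzero scalar of `K`. -/
def homothety : Setoid (Lattice O K d) where
  r M N := ∃ c : K, c ≠ 0 ∧ N.1 = c • M.1
  iseqv :=
    { refl := fun M => ⟨1, one_ne_zero, (one_smul _ _).symm⟩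
      symm := by
        rintro M N ⟨c, hc, h⟩
        exact ⟨c⁻¹, inv_ne_zero hc, by rw [h, inv_smul_smul₀ hc]⟩
      trans := by
        rintro M N P ⟨c, hc, h⟩ ⟨e, he, h'⟩
        exact ⟨e * c, mul_ne_zero he hc, by rw [h', h, mul_smul]⟩ }

/-- The vertices of the building of `PGL_{d+1}(K)`: homothety classes `[M]` of lattices. -/
def Vertex : Type _ := Quotient (homothety O K d)

variable {O K d}

/-- The vertex `[M]`. -/
def Lattice.toVertex (M : Lattice O K d) : Vertex O K d := Quotient.mk (homothety O K d) M

/-- The lattice spanned over `O` by a `K`-basis of `K^{d+1}`. -/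
def basisLattice (f : Module.Basis (Fin (d + 1)) K (Fin (d + 1) → K)) : Lattice O K d :=
  ⟨Submodule.span O (Set.range f),
    { fg := Submodule.fg_span (Set.finite_range f)
      span_eq_top := by
        refine top_le_iff.mp (le_trans f.span_eq.ge ?_)
        exact Submodule.span_mono Submodule.subset_span }⟩

variable (O K d) in
/-- The standard vertex `s₀ = [O^{d+1}]`. -/
def standardVertex : Vertex O K d :=
  (basisLattice (Pi.basisFun K (Fin (d + 1)))).toVertex

/-- A set of vertices is a simplex if it is of the form `{[M₀], …, [M_k]}` for a chain of lattices
`ϖ M_k ⊊ M₀ ⊊ M₁ ⊊ ⋯ ⊊ M_k`. -/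
def IsSimplex (ϖ : O) (σ : Set (Vertex O K d)) : Prop :=
  ∃ (k : ℕ) (M : Fin (k + 1) → Lattice O K d),
    StrictMono (fun i => (M i).1) ∧ ϖ • (M (Fin.last k)).1 < (M 0).1 ∧
      σ = Set.range fun i => (M i).toVertex

variable (K d) in
/-- The `1`-skeleton of the building. -/
def skeletonGraph (ϖ : O) : SimpleGraph (Vertex O K d) where
  Adj s t := s ≠ t ∧ IsSimplex ϖ {s, t}
  symm := ⟨fun s t h => ⟨h.1.symm, by rw [Set.pair_comm]; exact h.2⟩⟩
  loopless := ⟨fun _ h => h.1 rfl⟩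

/-- The combinatorial distance `δ`: the length of a shortest path in the `1`-skeleton. -/
def combDist (ϖ : O) (s t : Vertex O K d) : ℕ∞ := (skeletonGraph K d ϖ).edist s t

variable (K d) in
/-- The topological realization `|BT|`: a point is a formal convex combination of vertices
(its barycentric coordinates) whose support is a simplex. -/
@[ext]
structure Realization (ϖ : O) where
  /-- The barycentric coordinates. -/
  weight : Vertex O K d →₀ ℝ
  nonneg : ∀ s, 0 ≤ weight s
  sum_eq_one : (weight.sum fun _ w => w) = 1
  isSimplex_support : IsSimplex ϖ (weight.support : Set (Vertex O K d))

/-- The closed simplex `|τ|` inside `|BT|`. -/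
def closedSimplex (ϖ : O) (τ : Set (Vertex O K d)) : Set (Realization K d ϖ) :=
  {x | (x.weight.support : Set (Vertex O K d)) ⊆ τ}

/-- The closed star of a vertex `s`: the union of the closed simplices having `s` as a vertex. -/
def closedStar (ϖ : O) (s : Vertex O K d) : Set (Realization K d ϖ) :=
  ⋃ τ ∈ {τ : Set (Vertex O K d) | IsSimplex ϖ τ ∧ s ∈ τ}, closedSimplex ϖ τ

variable (K d) in
/-- The ball `B(n)`: the point `s₀` if `n = 0`, and the union of the closed stars of all vertices
`s` with `δ(s₀, s) ≤ n - 1` if `n ≥ 1`. -/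
def ball (ϖ : O) : ℕ → Set (Realization K d ϖ)
  | 0 => closedSimplex ϖ {standardVertex O K d}
  | n + 1 => ⋃ s ∈ {s | combDist ϖ (standardVertex O K d) s ≤ (n : ℕ∞)}, closedStar ϖ s

end Complex

section Metric

variable {O K : Type*} [CommRing O] [IsDomain O] [Field K] [Algebra O K] [IsFractionRing O K]
  {d : ℕ}

/-- The rescaled basis `(ϖ^{α₀} f₀, …, ϖ^{α_d} f_d)`. -/
def scaledBasis (ϖ : O) (hϖ : Irreducible ϖ)
    (f : Module.Basis (Fin (d + 1)) K (Fin (d + 1) → K)) (α : Fin (d + 1) → ℤ) :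
    Module.Basis (Fin (d + 1)) K (Fin (d + 1) → K) :=
  f.unitsSMul fun i =>
    (Units.mk0 (algebraMap O K ϖ)
      ((map_ne_zero_iff _ (IsFractionRing.injective O K)).mpr hϖ.ne_zero)) ^ α i

/-- The vertex `[⨁ᵢ O ϖ^{αᵢ} fᵢ]` of the apartment of the basis `f`. -/
def apartmentVertex (ϖ : O) (hϖ : Irreducible ϖ)
    (f : Module.Basis (Fin (d + 1)) K (Fin (d + 1) → K)) (α : Fin (d + 1) → ℤ) :
    Vertex O K d :=
  (basisLattice (scaledBasis ϖ hϖ f α)).toVertex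

/-- The Euclidean space `ℝ^{d+1} / ℝ·(1, …, 1)`, with the quotient of the Euclidean norm. -/
abbrev ModelSpace (d : ℕ) : Type :=
  EuclideanSpace ℝ (Fin (d + 1)) ⧸
    Submodule.span ℝ {(WithLp.toLp 2 (fun _ => 1) : EuclideanSpace ℝ (Fin (d + 1)))}

/-- The class of an integral vector `α` in `ℝ^{d+1} / ℝ·(1, …, 1)`. -/
def integralPoint (α : Fin (d + 1) → ℤ) : ModelSpace d :=
  Submodule.Quotient.mk (WithLp.toLp 2 fun i => (α i : ℝ))

/-- `x` lies in the apartment of the basis `f`, and its image under the affine identification of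
this apartment with `ℝ^{d+1} / ℝ·(1, …, 1)` (sending the vertex `[⨁ᵢ O ϖ^{αᵢ} fᵢ]` to the class of
`α`) is `u`. -/
def IsApartmentCoord (ϖ : O) (hϖ : Irreducible ϖ)
    (f : Module.Basis (Fin (d + 1)) K (Fin (d + 1) → K)) (x : Realization K d ϖ)
    (u : ModelSpace d) : Prop :=
  ∃ α : Vertex O K d → Fin (d + 1) → ℤ,
    (∀ s ∈ x.weight.support, apartmentVertex ϖ hϖ f (α s) = s) ∧
      u = x.weight.sum fun s w => w • integralPoint (α s)

/-- The distance on `|BT|` glued from the Euclidean distances of the apartments: the Euclidean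
distance of the coordinates of `x` and `y` in an apartment containing both (any two points have a
common apartment, and all of them give the same value; the infimum runs over all of them). -/
def euclDist (ϖ : O) (hϖ : Irreducible ϖ) (x y : Realization K d ϖ) : ℝ :=
  sInf {r | ∃ (f : Module.Basis (Fin (d + 1)) K (Fin (d + 1) → K)) (u v : ModelSpace d),
    IsApartmentCoord ϖ hϖ f x u ∧ IsApartmentCoord ϖ hϖ f y v ∧ r = dist u v}

/-- `γ`, restricted to `[0, 1]`, is a geodesic from `x` to `y` (parametrized proportionally to arc
length) for the distance of `|BT|`. -/
def IsGeodesic (ϖ : O) (hϖ : Irreducible ϖ) (x y : Realization K d ϖ)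
    (γ : ℝ → Realization K d ϖ) : Prop :=
  γ 0 = x ∧ γ 1 = y ∧ ∀ s ∈ Set.Icc (0 : ℝ) 1, ∀ t ∈ Set.Icc (0 : ℝ) 1,
    euclDist ϖ hϖ (γ s) (γ t) = |s - t| * euclDist ϖ hϖ x y

/-- `Y ⊆ |BT|` is geodesically convex (also called geodesically contractible): every geodesic
joining two points of `Y` is contained in `Y`. -/
def IsGeodesicallyConvex (ϖ : O) (hϖ : Irreducible ϖ) (Y : Set (Realization K d ϖ)) : Prop :=
  ∀ x ∈ Y, ∀ y ∈ Y, ∀ γ : ℝ → Realization K d ϖ, IsGeodesic ϖ hϖ x y γ →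
    ∀ t ∈ Set.Icc (0 : ℝ) 1, γ t ∈ Y

end Metric

end

end BruhatTits

/-! Points of the building are treated as norms, following Goldman and Iwahori. A lattice is the
unit ball of an ultrametric norm with integral logarithms, and homothety only rescales this norm. A
point `x` gives `pointNorm x`, the weighted geometric mean of the norms of its vertices, defined up
to a factor. The apartment of a basis `f` consists of the points whose norm has `f` as an orthogonal
basis (`Splits`); its coordinates are the log N(f i) modulo constants.

Geodesics are segments of apartments. Any two norms have a common orthogonal basis
(`exists_common_apartment`). For an ordered basis `f`, taking the minimum of a norm on each coset f
i + span(f j, j < i) is a retraction onto the apartment of `f`. It does not increase distances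
(`sum_sq_log_flagReduced_le`): along a segment of another apartment it is continuous, and it is
isometric on the times sharing one of the finitely many patterns of Gaussian pivots. Hence the
distance does not depend on the apartment (`euclDist_eq`). If `z` divides the distance from `x` to
`y` in the ratio t : 1 - t, with `x` and `y` in the apartment of `f`, then strict convexity places
each retraction of `z` at the corresponding point of the segment. Since all orderings of `f` give
the same answer, `z` itself lies in the apartment (`splits_of_forall_flagReduced`,
`splits_of_euclDist_eq`).

Balls are sublevel sets: B(n) is the set of `x` for which log(N_x / N_{s₀}) has oscillation at most
n (`mem_ball_iff`), a condition preserved along segments of apartments (`LogOsc.convex`). -/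

namespace BruhatTits

noncomputable section

/-! ### Ultrametric norms and orthogonal bases -/

section UltraNorm

variable {K V : Type*} [Field K] [AddCommGroup V] [Module K V]

/-- An ultrametric norm on a vector space over a field with an absolute value. -/
structure IsUltraNorm (abv : AbsoluteValue K ℝ) (N : V → ℝ) : Prop where
  smul : ∀ a v, N (a • v) = abv a * N v
  add_le : ∀ v w, N (v + w) ≤ max (N v) (N w)
  pos : ∀ v, v ≠ 0 → 0 < N v

variable {abv : AbsoluteValue K ℝ} {N N' : V → ℝ}

namespace IsUltraNorm

lemma map_zero (hN : IsUltraNorm abv N) : N 0 = 0 := by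
  have := hN.smul 0 0
  simpa using this

lemma nonneg (hN : IsUltraNorm abv N) (v : V) : 0 ≤ N v := by
  rcases eq_or_ne v 0 with rfl | h
  · exact hN.map_zero.ge
  · exact (hN.pos v h).le

lemma neg (hN : IsUltraNorm abv N) (v : V) : N (-v) = N v := by
  have := hN.smul (-1) v
  simpa using this

lemma sub_le (hN : IsUltraNorm abv N) (v w : V) : N (v - w) ≤ max (N v) (N w) := by
  rw [sub_eq_add_neg, ← hN.neg w]
  exact hN.add_le _ _

lemma sum_le (hN : IsUltraNorm abv N) {ι : Type*} (s : Finset ι) (v : ι → V) {C : ℝ}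
    (hC : 0 ≤ C) (h : ∀ i ∈ s, N (v i) ≤ C) : N (∑ i ∈ s, v i) ≤ C := by
  classical
  induction s using Finset.induction_on with
  | empty => simpa [hN.map_zero] using hC
  | insert a s ha ih =>
    rw [Finset.sum_insert ha]
    exact (hN.add_le _ _).trans
      (max_le (h _ (Finset.mem_insert_self _ _)) (ih fun i hi => h i (Finset.mem_insert_of_mem hi)))

lemma const_mul (hN : IsUltraNorm abv N) {c : ℝ} (hc : 0 < c) :
    IsUltraNorm abv (fun v => c * N v) where
  smul a v := by rw [hN.smul]; ring
  add_le v w := by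
    rw [← mul_max_of_nonneg _ _ hc.le]
    exact mul_le_mul_of_nonneg_left (hN.add_le v w) hc.le
  pos v hv := mul_pos hc (hN.pos v hv)

end IsUltraNorm

/-- The basis `f` is orthogonal for the norm `N`. -/
def Splits {ι : Type*} (abv : AbsoluteValue K ℝ) (f : Module.Basis ι K V) (N : V → ℝ) : Prop :=
  ∀ v i, abv (f.repr v i) * N (f i) ≤ N v

section Split

variable {ι : Type*} [Fintype ι] {g : Module.Basis ι K V}

lemma IsUltraNorm.le_of_repr (hN : IsUltraNorm abv N) (g : Module.Basis ι K V) {v : V} {C : ℝ}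
    (hC : 0 ≤ C) (h : ∀ i, abv (g.repr v i) * N (g i) ≤ C) : N v ≤ C := by
  rw [← g.sum_repr v]
  exact hN.sum_le _ _ hC fun i _ => by rw [hN.smul]; exact h i

lemma Splits.le_iff (hg : Splits abv g N) (hN : IsUltraNorm abv N) {v : V} {C : ℝ}
    (hC : 0 ≤ C) : N v ≤ C ↔ ∀ i, abv (g.repr v i) * N (g i) ≤ C :=
  ⟨fun h i => (hg v i).trans h, hN.le_of_repr g hC⟩

lemma IsUltraNorm.exists_repr (hN : IsUltraNorm abv N) (g : Module.Basis ι K V) {v : V}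
    (hv : v ≠ 0) : ∃ i, N v ≤ abv (g.repr v i) * N (g i) := by
  have hne : Nonempty ι := by
    by_contra h
    rw [not_nonempty_iff] at h
    exact hv (by rw [← g.sum_repr v]; simp)
  obtain ⟨i, -, hi⟩ := Finset.exists_max_image Finset.univ
    (fun i => abv (g.repr v i) * N (g i)) Finset.univ_nonempty
  exact ⟨i, hN.le_of_repr g (mul_nonneg (abv.nonneg _) (hN.nonneg _))
    fun j => hi j (Finset.mem_univ j)⟩

/-- The norm for which the basis `g` is orthogonal and `g i` has norm `exp (u i)`. -/
noncomputable def splitNorm (abv : AbsoluteValue K ℝ) (g : Module.Basis ι K V) (u : ι → ℝ)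
    (v : V) : ℝ :=
  ‖fun i => abv (g.repr v i) * Real.exp (u i)‖

lemma splitNorm_le_iff {u : ι → ℝ} {v : V} {C : ℝ} (hC : 0 ≤ C) :
    splitNorm abv g u v ≤ C ↔ ∀ i, abv (g.repr v i) * Real.exp (u i) ≤ C := by
  rw [splitNorm, pi_norm_le_iff_of_nonneg hC]
  refine forall_congr' fun i => ?_
  rw [Real.norm_of_nonneg (mul_nonneg (abv.nonneg _) (Real.exp_pos _).le)]

lemma le_splitNorm (abv : AbsoluteValue K ℝ) (g : Module.Basis ι K V) (u : ι → ℝ) (v : V)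
    (i : ι) : abv (g.repr v i) * Real.exp (u i) ≤ splitNorm abv g u v :=
  (splitNorm_le_iff (norm_nonneg _)).1 le_rfl i

lemma isUltraNorm_splitNorm (hna : IsNonarchimedean abv) (g : Module.Basis ι K V) (u : ι → ℝ) :
    IsUltraNorm abv (splitNorm abv g u) where
  smul a v := by
    have : (fun i => abv (g.repr (a • v) i) * Real.exp (u i)) =
        abv a • fun i => abv (g.repr v i) * Real.exp (u i) := by
      ext i; simp [mul_assoc]
    rw [splitNorm, this, norm_smul, Real.norm_of_nonneg (abv.nonneg _), splitNorm]
  add_le v w := by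
    refine (splitNorm_le_iff (le_max_of_le_left (norm_nonneg _))).2 fun i => ?_
    have h1 := hna (g.repr v i) (g.repr w i)
    have h2 := le_splitNorm abv g u v i
    have h3 := le_splitNorm abv g u w i
    rw [map_add, Finsupp.add_apply]
    refine (mul_le_mul_of_nonneg_right h1 (Real.exp_pos _).le).trans ?_
    rw [max_mul_of_nonneg _ _ (Real.exp_pos _).le]
    exact max_le_max h2 h3
  pos v hv := by
    obtain ⟨i, hi⟩ : ∃ i, g.repr v i ≠ 0 := by
      by_contra! h
      exact hv (by rw [← g.sum_repr v]; simp [h])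
    exact (mul_pos (abv.pos hi) (Real.exp_pos _)).trans_le (le_splitNorm abv g u v i)

lemma splitNorm_basis (abv : AbsoluteValue K ℝ) (g : Module.Basis ι K V) (u : ι → ℝ) (i : ι) :
    splitNorm abv g u (g i) = Real.exp (u i) := by
  classical
  refine le_antisymm ((splitNorm_le_iff (Real.exp_pos _).le).2 fun j => ?_) ?_
  · rw [g.repr_self, Finsupp.single_apply]
    split_ifs with h
    · simp [h]
    · simpa using (Real.exp_pos _).le
  · simpa using le_splitNorm abv g u (g i) i

lemma splits_splitNorm (abv : AbsoluteValue K ℝ) (g : Module.Basis ι K V) (u : ι → ℝ) :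
    Splits abv g (splitNorm abv g u) := fun v i => by
  rw [splitNorm_basis]; exact le_splitNorm abv g u v i

lemma Splits.eq_splitNorm (hg : Splits abv g N) (hN : IsUltraNorm abv N) {u : ι → ℝ}
    (hu : ∀ i, N (g i) = Real.exp (u i)) : N = splitNorm abv g u := by
  ext v
  refine le_antisymm (hN.le_of_repr g (norm_nonneg _) fun i => ?_)
    ((splitNorm_le_iff (hN.nonneg v)).2 fun i => ?_)
  · rw [hu]; exact le_splitNorm abv g u v i
  · rw [← hu]; exact hg v i

end Split

/-! ### Minimal vectors in the cosets of a flag, by Gaussian elimination -/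

section Flag

variable {n : ℕ} {ι : Type*}

/-- `x` is an element of least norm in the coset of `f i` modulo the span of the `f j`, `j < i`. -/
def IsFlagReduced (f : Fin n → V) (K : Type*) [Field K] [Module K V] (N : V → ℝ) (i : Fin n)
    (x : V) : Prop :=
  x - f i ∈ Submodule.span K (f '' Set.Iio i) ∧
    ∀ y, y - f i ∈ Submodule.span K (f '' Set.Iio i) → N x ≤ N y

/-- `h i` is obtained from `f i` by Gaussian elimination along the basis `g` with pivots `w`, the
pivot being a coordinate of greatest contribution to the norm. -/
structure IsPivot (abv : AbsoluteValue K ℝ) (g : Module.Basis ι K V) (N : V → ℝ) (f h : Fin n → V)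
    (w : Fin n → ι) (i : Fin n) : Prop where
  mem : h i - f i ∈ Submodule.span K (f '' Set.Iio i)
  zero : ∀ l < i, g.repr (h i) (w l) = 0
  le : N (h i) ≤ abv (g.repr (h i) (w i)) * N (g (w i))

variable {g : Module.Basis ι K V} {f h : Fin n → V} {w : Fin n → ι}

lemma ne_zero_of_sub_mem_span (hf : LinearIndependent K f) {i : Fin n} {x : V}
    (hx : x - f i ∈ Submodule.span K (f '' Set.Iio i)) : x ≠ 0 := by
  rintro rfl
  rw [zero_sub, neg_mem_iff] at hx
  exact hf.notMem_span_image (s := Set.Iio i) (x := i) (lt_irrefl i) hx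

lemma IsPivot.repr_ne_zero {i : Fin n} (hp : IsPivot abv g N f h w i)
    (hf : LinearIndependent K f) (hN : IsUltraNorm abv N) : g.repr (h i) (w i) ≠ 0 := by
  intro h0
  have h1 := hp.le
  rw [h0, _root_.map_zero, zero_mul] at h1
  exact (hN.pos _ (ne_zero_of_sub_mem_span hf hp.mem)).not_ge h1

lemma IsPivot.mem_span {i l : Fin n} (hp : IsPivot abv g N f h w l) (hl : l < i) :
    h l ∈ Submodule.span K (f '' Set.Iio i) := by
  rw [← sub_add_cancel (h l) (f l)]
  exact add_mem (Submodule.span_mono (Set.image_mono (Set.Iio_subset_Iio hl.le)) hp.mem)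
    (Submodule.subset_span ⟨l, hl, rfl⟩)

/-- Eliminate the pivots in increasing order; `h l` vanishes at earlier pivots, so zeros already
made survive. The norm does not grow because the pivot coordinate carries the whole norm of `h l`:
the multiple subtracted has norm at most the contribution of one coordinate of the current vector.
-/
lemma exists_reduce (hf : LinearIndependent K f) (hN : IsUltraNorm abv N) (hg : Splits abv g N)
    (i : Fin n) (hp : ∀ l < i, IsPivot abv g N f h w l) (y : V) :
    ∃ y', y' - y ∈ Submodule.span K (f '' Set.Iio i) ∧ (∀ l < i, g.repr y' (w l) = 0) ∧
      N y' ≤ N y := by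
  suffices H : ∀ m : ℕ, m ≤ i.1 → ∃ y', y' - y ∈ Submodule.span K (f '' Set.Iio i) ∧
      (∀ l : Fin n, l.1 < m → g.repr y' (w l) = 0) ∧ N y' ≤ N y from H i.1 le_rfl
  intro m
  induction m with
  | zero => exact fun _ => ⟨y, by simp, fun l hl => absurd hl (Nat.not_lt_zero _), le_rfl⟩
  | succ m ih =>
    intro hm
    obtain ⟨y', h1, h2, h3⟩ := ih (by omega)
    let l₀ : Fin n := ⟨m, by omega⟩
    have hl₀ : l₀ < i := Fin.lt_def.2 hm
    have hne := (hp l₀ hl₀).repr_ne_zero hf hN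
    set c := g.repr y' (w l₀) / g.repr (h l₀) (w l₀) with hc
    refine ⟨y' - c • h l₀, ?_, fun l hl => ?_, ?_⟩
    · rw [sub_right_comm]
      exact sub_mem h1 (Submodule.smul_mem _ _ ((hp l₀ hl₀).mem_span hl₀))
    · rw [map_sub, map_smul, Finsupp.sub_apply, Finsupp.smul_apply, smul_eq_mul]
      rcases Nat.lt_succ_iff_lt_or_eq.1 hl with h' | h'
      · rw [h2 l h', (hp l₀ hl₀).zero l (Fin.lt_def.2 h')]; simp
      · obtain rfl : l = l₀ := Fin.ext h'
        rw [hc, div_mul_cancel₀ _ hne, sub_self]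
    · refine (hN.sub_le _ _).trans (max_le h3 ?_)
      rw [hN.smul]
      calc abv c * N (h l₀)
          ≤ abv c * (abv (g.repr (h l₀) (w l₀)) * N (g (w l₀))) :=
            mul_le_mul_of_nonneg_left (hp l₀ hl₀).le (abv.nonneg _)
        _ = abv (g.repr y' (w l₀)) * N (g (w l₀)) := by
            rw [← mul_assoc, ← map_mul, hc, div_mul_cancel₀ _ hne]
        _ ≤ N y' := hg _ _
        _ ≤ N y := h3

lemma span_le_span_of_isPivot (i : Fin n) (hp : ∀ l < i, IsPivot abv g N f h w l) :
    Submodule.span K (f '' Set.Iio i) ≤ Submodule.span K (h '' Set.Iio i) := by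
  induction i using WellFoundedLT.induction with
  | ind i ih =>
    rw [Submodule.span_le]
    rintro _ ⟨l, hl, rfl⟩
    rw [← sub_sub_cancel (h l) (f l)]
    refine sub_mem (Submodule.subset_span ⟨l, hl, rfl⟩) ?_
    exact Submodule.span_mono (Set.image_mono (Set.Iio_subset_Iio (le_of_lt hl)))
      (ih l hl (fun k hk => hp k (hk.trans hl)) (hp l hl).mem)

/-- The matrix of pivot coordinates of the `h l` is triangular with nonzero diagonal, so the
vanishing coordinates kill the coefficients of `y` one at a time. -/
lemma eq_zero_of_repr_pivot (hf : LinearIndependent K f) (hN : IsUltraNorm abv N)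
    (i : Fin n) (hp : ∀ l < i, IsPivot abv g N f h w l) {y : V}
    (hy : y ∈ Submodule.span K (f '' Set.Iio i)) (h0 : ∀ l < i, g.repr y (w l) = 0) : y = 0 := by
  suffices H : ∀ m : ℕ, m ≤ i.1 → y ∈ Submodule.span K (h '' {l | m ≤ l.1 ∧ l < i}) by
    have := H i.1 le_rfl
    have he : {l : Fin n | i.1 ≤ l.1 ∧ l < i} = ∅ := by
      ext l; simp only [Set.mem_ofPred_eq, Set.mem_empty_iff_false, Fin.lt_def, iff_false]; omega
    rwa [he, Set.image_empty, Submodule.span_empty, Submodule.mem_bot] at this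
  intro m
  induction m with
  | zero =>
    intro _
    have := span_le_span_of_isPivot i hp hy
    refine Submodule.span_mono (Set.image_mono ?_) this
    exact fun l hl => ⟨Nat.zero_le l.1, hl⟩
  | succ m ih =>
    intro hm
    have hy' := ih (by omega)
    let l₀ : Fin n := ⟨m, by omega⟩
    have hl₀ : l₀ < i := Fin.lt_def.2 hm
    have he : {l : Fin n | m ≤ l.1 ∧ l < i} = insert l₀ {l : Fin n | m + 1 ≤ l.1 ∧ l < i} := by
      ext l
      simp only [Set.mem_ofPred_eq, Set.mem_insert_iff, Fin.lt_def, Fin.ext_iff, l₀]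
      omega
    rw [he, Set.image_insert_eq, Submodule.mem_span_insert] at hy'
    obtain ⟨a, z, hz, rfl⟩ := hy'
    have hz0 : g.repr z (w l₀) = 0 := by
      have hle : Submodule.span K (h '' {l : Fin n | m + 1 ≤ l.1 ∧ l < i}) ≤
          LinearMap.ker (g.coord (w l₀)) := by
        rw [Submodule.span_le]
        rintro _ ⟨l, hl, rfl⟩
        exact (hp l hl.2).zero l₀ (Fin.lt_def.2 hl.1)
      exact hle hz
    have ha := h0 l₀ hl₀
    rw [map_add, map_smul, Finsupp.add_apply, Finsupp.smul_apply, hz0, add_zero, smul_eq_mul,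
      mul_eq_zero, or_iff_left ((hp l₀ hl₀).repr_ne_zero hf hN)] at ha
    simpa [ha] using hz

lemma exists_isPivot [Fintype ι] (hf : LinearIndependent K f) (hN : IsUltraNorm abv N) (hg : Splits abv g N) :
    ∃ (h : Fin n → V) (w : Fin n → ι), ∀ i, IsPivot abv g N f h w i := by
  suffices H : ∀ m : ℕ, m ≤ n → ∃ (h : Fin n → V) (w : Fin n → ι),
      ∀ i : Fin n, i.1 < m → IsPivot abv g N f h w i by
    obtain ⟨h, w, H⟩ := H n le_rfl
    exact ⟨h, w, fun i => H i i.2⟩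
  intro m
  induction m with
  | zero =>
    intro _
    rcases n with _ | n
    · exact ⟨Fin.elim0, Fin.elim0, fun i => i.elim0⟩
    -- Only a default value for `w` is needed; the nonzero vector `f 0` shows that `ι` is inhabited.
    · obtain ⟨j, -⟩ := hN.exists_repr g (hf.ne_zero 0)
      exact ⟨f, fun _ => j, fun i hi => absurd hi (Nat.not_lt_zero _)⟩
  | succ m ih =>
    intro hm
    obtain ⟨h, w, hp⟩ := ih (by omega)
    let i₀ : Fin n := ⟨m, by omega⟩
    obtain ⟨y, h1, h2, -⟩ := exists_reduce hf hN hg i₀ (fun l hl => hp l hl) (f i₀)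
    obtain ⟨j, hj⟩ := hN.exists_repr g (ne_zero_of_sub_mem_span hf h1)
    refine ⟨Function.update h i₀ y, Function.update w i₀ j, fun i hi => ?_⟩
    rcases Nat.lt_succ_iff_lt_or_eq.1 hi with h' | h'
    · have hne : i ≠ i₀ := fun h => h'.ne (congrArg Fin.val h)
      have hlt : ∀ l < i, l ≠ i₀ := fun l hl h => (hl.trans (Fin.lt_def.2 h' : i < i₀)).ne h
      have := hp i h'
      exact ⟨by simpa [hne] using this.mem,
        fun l hl => by simpa [hne, hlt l hl] using this.zero l hl, by simpa [hne] using this.le⟩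
    · obtain rfl : i = i₀ := Fin.ext h'
      exact ⟨by simpa using h1, fun l hl => by simpa [hl.ne] using h2 l hl, by simpa using hj⟩

/-- Reducing any competitor `y` does not increase its norm, and the result is `h i`, the only vector
of the coset with vanishing earlier pivot coordinates. -/
lemma IsPivot.isFlagReduced (hf : LinearIndependent K f) (hN : IsUltraNorm abv N)
    (hg : Splits abv g N) (hp : ∀ i, IsPivot abv g N f h w i) (i : Fin n) :
    IsFlagReduced f K N i (h i) := by
  refine ⟨(hp i).mem, fun y hy => ?_⟩
  obtain ⟨y', h1, h2, h3⟩ := exists_reduce hf hN hg i (fun l _ => hp l) y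
  have : y' - h i = 0 := by
    refine eq_zero_of_repr_pivot hf hN i (fun l _ => hp l) ?_ fun l hl => ?_
    · have := sub_mem (add_mem h1 hy) (hp i).mem
      convert this using 1; abel
    · rw [map_sub, Finsupp.sub_apply, h2 l hl, (hp i).zero l hl, sub_zero]
  rwa [← sub_eq_zero.1 this]

lemma exists_isFlagReduced [Fintype ι] (hf : LinearIndependent K f) (hN : IsUltraNorm abv N)
    (hg : Splits abv g N) : ∃ h : Fin n → V, ∀ i, IsFlagReduced f K N i (h i) := by
  obtain ⟨h, w, hp⟩ := exists_isPivot hf hN hg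
  exact ⟨h, IsPivot.isFlagReduced hf hN hg hp⟩

/-- The reduced vectors only depend on the pivots. -/
lemma IsPivot.eq_of_eq (hf : LinearIndependent K f) (hN : IsUltraNorm abv N) {h' : Fin n → V}
    (hp : ∀ i, IsPivot abv g N f h w i) (hp' : ∀ i, IsPivot abv g N' f h' w i) : h = h' := by
  ext i
  refine sub_eq_zero.1 (eq_zero_of_repr_pivot hf hN i (fun l _ => hp l) ?_ fun l hl => ?_)
  · have := sub_mem (hp i).mem (hp' i).mem
    convert this using 1; abel
  · rw [map_sub, Finsupp.sub_apply, (hp' i).zero l hl, (hp i).zero l hl, sub_zero]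

lemma IsPivot.injective (hf : LinearIndependent K f) (hN : IsUltraNorm abv N)
    (hp : ∀ i, IsPivot abv g N f h w i) : Function.Injective w := by
  intro i j hij
  by_contra hne
  rcases lt_or_gt_of_ne hne with hlt | hlt
  · exact (hp j).repr_ne_zero hf hN (hij ▸ (hp j).zero i hlt)
  · exact (hp i).repr_ne_zero hf hN (hij ▸ (hp i).zero j hlt)

lemma IsPivot.log_eq {i : Fin n} (hp : IsPivot abv g N f h w i) (hf : LinearIndependent K f)
    (hN : IsUltraNorm abv N) (hg : Splits abv g N) :
    Real.log (N (h i)) = Real.log (abv (g.repr (h i) (w i))) + Real.log (N (g (w i))) := by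
  rw [le_antisymm hp.le (hg _ _), Real.log_mul (abv.ne_zero (hp.repr_ne_zero hf hN))
    (hN.pos _ (g.ne_zero _)).ne']

/-- For equal pivots the reduced vectors coincide and their pivot coefficients cancel. The
retraction thus acts on differences of coordinates as the permutation `w`, which is an isometry. -/
lemma IsPivot.log_sub_log (hf : LinearIndependent K f) (hN : IsUltraNorm abv N)
    (hN' : IsUltraNorm abv N') (hg : Splits abv g N) (hg' : Splits abv g N') {h' : Fin n → V}
    (hp : ∀ i, IsPivot abv g N f h w i) (hp' : ∀ i, IsPivot abv g N' f h' w i) (i : Fin n) :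
    Real.log (N (h i)) - Real.log (N' (h' i)) =
      Real.log (N (g (w i))) - Real.log (N' (g (w i))) := by
  rw [(hp i).log_eq hf hN hg, (hp' i).log_eq hf hN' hg', IsPivot.eq_of_eq hf hN hp hp']
  ring

end Flag

end UltraNorm

/-! ### The retraction onto an apartment is 1-Lipschitz -/

section Lipschitz

/-- A continuous path that is `L`-Lipschitz on each part of a finite partition of the line is
`L`-Lipschitz. -/
lemma dist_le_of_lipschitz_on_parts {E W : Type*} [PseudoMetricSpace E] [Finite W] {φ : ℝ → E}
    (hφ : Continuous φ) (c : ℝ → W) (L : NNReal)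
    (hL : ∀ s t, c s = c t → dist (φ s) (φ t) ≤ L * dist s t) {a b : ℝ} (hab : a ≤ b) :
    dist (φ a) (φ b) ≤ L * (b - a) := by
  classical
  have := Fintype.ofFinite W
  -- Induction on the set of parts met in the open interval; no part needs to be an interval.
  suffices H : ∀ (T : Finset W) (a b : ℝ), a ≤ b → (∀ t ∈ Set.Ioo a b, c t ∈ T) →
      dist (φ a) (φ b) ≤ L * (b - a) from H Finset.univ a b hab fun t _ => Finset.mem_univ _
  intro T
  induction T using Finset.induction_on with
  | empty =>
    intro a b hab h
    have : ¬ a < b := fun h' => by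
      obtain ⟨t, ht⟩ := Set.nonempty_Ioo.2 h'
      exact absurd (h t ht) (Finset.notMem_empty _)
    obtain rfl : a = b := le_antisymm hab (not_lt.1 this)
    simp
  | insert k T _ ih =>
    intro a b hab h
    by_cases hk : ∃ t ∈ Set.Ioo a b, c t = k
    swap
    · push Not at hk
      exact ih a b hab fun t ht => (Finset.mem_insert.1 (h t ht)).resolve_left (hk t ht)
    obtain ⟨t₀, ht₀, hct₀⟩ := hk
    -- By continuity the Lipschitz bound passes to the closure of the part `k`. It is applied
    -- between the first and last points of `A`; outside them `k` no longer occurs and induction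
    -- takes over.
    set A : Set ℝ := closure {t | t ∈ Set.Icc a b ∧ c t = k} with hA
    have hsub : A ⊆ Set.Icc a b := closure_minimal (fun t ht => ht.1) isClosed_Icc
    have hcomp : IsCompact A := isCompact_Icc.of_isClosed_subset isClosed_closure hsub
    have hmem : t₀ ∈ A := subset_closure ⟨⟨ht₀.1.le, ht₀.2.le⟩, hct₀⟩
    have hlip : LipschitzOnWith L φ A := by
      refine LipschitzOnWith.closure hφ.continuousOn (LipschitzOnWith.of_dist_le_mul ?_)
      intro s hs t ht
      exact hL s t (hs.2.trans ht.2.symm)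
    obtain ⟨t₁, h1, h1'⟩ := hcomp.exists_isLeast ⟨t₀, hmem⟩
    obtain ⟨t₂, h2, h2'⟩ := hcomp.exists_isGreatest ⟨t₀, hmem⟩
    have h12 : t₁ ≤ t₂ := h1' h2
    have e1 : dist (φ a) (φ t₁) ≤ L * (t₁ - a) := by
      refine ih a t₁ (hsub h1).1 fun t ht => ?_
      have htb : t < b := ht.2.trans_le (hsub h1).2
      refine (Finset.mem_insert.1 (h t ⟨ht.1, htb⟩)).resolve_left fun hc => ?_
      exact ht.2.not_ge (h1' (subset_closure ⟨⟨ht.1.le, htb.le⟩, hc⟩))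
    have e2 : dist (φ t₂) (φ b) ≤ L * (b - t₂) := by
      refine ih t₂ b (hsub h2).2 fun t ht => ?_
      have hta : a < t := (hsub h2).1.trans_lt ht.1
      refine (Finset.mem_insert.1 (h t ⟨hta, ht.2⟩)).resolve_left fun hc => ?_
      exact ht.1.not_ge (h2' (subset_closure ⟨⟨hta.le, ht.2.le⟩, hc⟩))
    have e3 : dist (φ t₁) (φ t₂) ≤ L * (t₂ - t₁) := by
      have := hlip.dist_le_mul t₁ h1 t₂ h2
      rwa [Real.dist_eq, abs_sub_comm, abs_of_nonneg (sub_nonneg.2 h12)] at this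
    calc dist (φ a) (φ b) ≤ dist (φ a) (φ t₁) + dist (φ t₁) (φ t₂) + dist (φ t₂) (φ b) :=
          dist_triangle4 _ _ _ _
      _ ≤ L * (t₁ - a) + L * (t₂ - t₁) + L * (b - t₂) := by gcongr
      _ = L * (b - a) := by ring

variable {K V : Type*} [Field K] [AddCommGroup V] [Module K V] {abv : AbsoluteValue K ℝ}
  {N N' : V → ℝ}

lemma splitNorm_le_exp_mul {ι : Type*} [Fintype ι] {g : Module.Basis ι K V} {u v : ι → ℝ} {δ : ℝ}
    (h : ∀ i, u i ≤ δ + v i) (x : V) :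
    splitNorm abv g u x ≤ Real.exp δ * splitNorm abv g v x := by
  refine (splitNorm_le_iff (mul_nonneg (Real.exp_pos _).le (norm_nonneg _))).2 fun i => ?_
  calc abv (g.repr x i) * Real.exp (u i)
      ≤ abv (g.repr x i) * (Real.exp δ * Real.exp (v i)) := by
        rw [← Real.exp_add]
        exact mul_le_mul_of_nonneg_left (Real.exp_le_exp.2 (h i)) (abv.nonneg _)
    _ = Real.exp δ * (abv (g.repr x i) * Real.exp (v i)) := by ring
    _ ≤ _ := mul_le_mul_of_nonneg_left (le_splitNorm abv g v x i) (Real.exp_pos _).le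

variable {n : ℕ} {f : Fin n → V}

/-- Both vectors lie in the same coset, so N x ≤ N y ≤ exp δ · N' y. This makes the retraction
continuous along a path of norms. -/
lemma IsFlagReduced.log_le (hf : LinearIndependent K f) (hN : IsUltraNorm abv N)
    (hN' : IsUltraNorm abv N') {δ : ℝ} (hle : ∀ x, N x ≤ Real.exp δ * N' x) {i : Fin n} {x y : V}
    (hx : IsFlagReduced f K N i x) (hy : IsFlagReduced f K N' i y) :
    Real.log (N x) ≤ δ + Real.log (N' y) := by
  have hy0 := hN'.pos _ (ne_zero_of_sub_mem_span hf hy.1)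
  rw [← Real.log_exp δ, ← Real.log_mul (Real.exp_pos _).ne' hy0.ne']
  exact Real.log_le_log (hN.pos _ (ne_zero_of_sub_mem_span hf hx.1)) ((hx.2 y hy.1).trans (hle y))

/-- The retraction onto the apartment of `f`, centred at the flag of `f`, does not increase the
distances of an apartment. -/
theorem sum_sq_log_flagReduced_le (hna : IsNonarchimedean abv) (hf : LinearIndependent K f)
    (hN : IsUltraNorm abv N) (hN' : IsUltraNorm abv N') {g : Module.Basis (Fin n) K V}
    (hg : Splits abv g N) (hg' : Splits abv g N') {h h' : Fin n → V}
    (hh : ∀ i, IsFlagReduced f K N i (h i)) (hh' : ∀ i, IsFlagReduced f K N' i (h' i)) :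
    ∑ i, (Real.log (N (h i)) - Real.log (N' (h' i))) ^ 2 ≤
      ∑ i, (Real.log (N (g i)) - Real.log (N' (g i))) ^ 2 := by
  set u : Fin n → ℝ := fun i => Real.log (N (g i)) with hu
  set v : Fin n → ℝ := fun i => Real.log (N' (g i)) with hv
  -- The straight segment from `N` to `N'` in the apartment of `g`; `φ` below is its retraction.
  let p : ℝ → Fin n → ℝ := fun t i => u i + t * (v i - u i)
  have hS : ∀ t, IsUltraNorm abv (splitNorm abv g (p t)) := fun t =>
    isUltraNorm_splitNorm hna g (p t)
  have hsp : ∀ t, Splits abv g (splitNorm abv g (p t)) := fun t => splits_splitNorm abv g (p t)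
  have hp0 : N = splitNorm abv g (p 0) := hg.eq_splitNorm hN fun i => by
    simp [p, hu, Real.exp_log (hN.pos _ (g.ne_zero i))]
  have hp1 : N' = splitNorm abv g (p 1) := hg'.eq_splitNorm hN' fun i => by
    simp [p, hv, Real.exp_log (hN'.pos _ (g.ne_zero i))]
  choose H w hH using fun t => exists_isPivot hf (hS t) (hsp t)
  have hred : ∀ t i, IsFlagReduced f K (splitNorm abv g (p t)) i (H t i) := fun t =>
    IsPivot.isFlagReduced hf (hS t) (hsp t) (hH t)
  let φ : ℝ → EuclideanSpace ℝ (Fin n) := fun t =>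
    WithLp.toLp 2 fun i => Real.log (splitNorm abv g (p t) (H t i))
  set D : ℝ := Real.sqrt (∑ i, (u i - v i) ^ 2) with hD
  have hD0 : 0 ≤ D := Real.sqrt_nonneg _
  have hcont : Continuous φ := by
    refine (PiLp.continuous_toLp 2 _).comp (continuous_pi fun i => ?_)
    -- A crude constant suffices here: only continuity is used, the sharp constant `D` coming from
    -- `hpart`.
    refine (LipschitzWith.of_le_add_mul (Real.toNNReal (∑ j, |v j - u j|)) fun s t => ?_).continuous
    rw [add_comm, Real.coe_toNNReal _ (Finset.sum_nonneg fun _ _ => abs_nonneg _)]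
    refine IsFlagReduced.log_le hf (hS s) (hS t) (fun x => splitNorm_le_exp_mul (fun j => ?_) x)
      (hred s i) (hred t i)
    have h1 : |v j - u j| ≤ ∑ j, |v j - u j| :=
      Finset.single_le_sum (f := fun j => |v j - u j|) (fun _ _ => abs_nonneg _)
        (Finset.mem_univ j)
    have h2 : (s - t) * (v j - u j) ≤ |v j - u j| * |s - t| := by
      rw [mul_comm, ← abs_mul]; exact le_abs_self _
    have h3 := mul_le_mul_of_nonneg_right h1 (abs_nonneg (s - t))
    rw [Real.dist_eq]
    simp only [p]
    linarith
  have hpart : ∀ s t, w s = w t → dist (φ s) (φ t) ≤ (Real.toNNReal D : ℝ) * dist s t := by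
    intro s t hst
    have hinj := IsPivot.injective hf (hS s) (hH s)
    have hbij : Function.Bijective (w s) := Finite.injective_iff_bijective.1 hinj
    have hH' : ∀ i, IsPivot abv g (splitNorm abv g (p t)) f (H t) (w s) i := hst ▸ hH t
    rw [Real.coe_toNNReal _ hD0, EuclideanSpace.dist_eq]
    have : ∀ i, dist (φ s i) (φ t i) ^ 2 = (dist s t) ^ 2 * (u (w s i) - v (w s i)) ^ 2 := by
      intro i
      have := IsPivot.log_sub_log hf (hS s) (hS t) (hsp s) (hsp t) (hH s) hH' i
      simp only [splitNorm_basis, Real.log_exp] at this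
      rw [Real.dist_eq, Real.dist_eq, sq_abs, sq_abs]
      simp only [φ, this, p]
      ring
    simp_rw [this]
    rw [← Finset.mul_sum, hbij.sum_comp (fun j => (u j - v j) ^ 2), Real.sqrt_mul (sq_nonneg _),
      Real.sqrt_sq dist_nonneg, mul_comm]
  have key := dist_le_of_lipschitz_on_parts hcont w _ hpart zero_le_one
  rw [Real.coe_toNNReal _ hD0, sub_zero, mul_one, EuclideanSpace.dist_eq, hD] at key
  rw [Real.sqrt_le_sqrt_iff (Finset.sum_nonneg fun _ _ => sq_nonneg _)] at key
  refine le_trans (le_of_eq (Finset.sum_congr rfl fun i _ => ?_)) key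
  -- A coset may have several minimal vectors, but only one minimal norm.
  have e0 : N (h i) = splitNorm abv g (p 0) (H 0 i) := by
    have := hred 0 i
    rw [← hp0] at this ⊢
    exact le_antisymm ((hh i).2 _ this.1) (this.2 _ (hh i).1)
  have e1 : N' (h' i) = splitNorm abv g (p 1) (H 1 i) := by
    have := hred 1 i
    rw [← hp1] at this ⊢
    exact le_antisymm ((hh' i).2 _ this.1) (this.2 _ (hh' i).1)
  rw [Real.dist_eq, sq_abs, e0, e1]

end Lipschitz

/-! ### Simultaneous orthogonal bases of two norms -/

section CommonSplitting

variable {K V : Type*} [Field K] [AddCommGroup V] [Module K V] {abv : AbsoluteValue K ℝ}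
  {N N' : V → ℝ}

/-- Every vector has a norming functional. -/
lemma Splits.exists_norming {ι : Type*} [Fintype ι] {g : Module.Basis ι K V}
    (hg : Splits abv g N) (hN : IsUltraNorm abv N) {v : V} (hv : v ≠ 0) :
    ∃ φ : V →ₗ[K] K, φ v = 1 ∧ ∀ w, abv (φ w) * N v ≤ N w := by
  obtain ⟨i, hi⟩ := hN.exists_repr g hv
  have hne : g.repr v i ≠ 0 := fun h => by
    rw [h, map_zero, zero_mul] at hi; exact (hN.pos v hv).not_ge hi
  refine ⟨(g.repr v i)⁻¹ • g.coord i, by simp [hne], fun w => ?_⟩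
  have hpos := abv.pos hne
  calc abv (((g.repr v i)⁻¹ • g.coord i) w) * N v
      ≤ abv (((g.repr v i)⁻¹ • g.coord i) w) * (abv (g.repr v i) * N (g i)) :=
        mul_le_mul_of_nonneg_left hi (abv.nonneg _)
    _ = abv (g.repr w i) * N (g i) := by
        simp only [LinearMap.smul_apply, Module.Basis.coord_apply, smul_eq_mul, map_mul, map_inv₀]
        field_simp
    _ ≤ N w := hg w i

/-- Two norms have a common orthogonal basis, provided that one of them has norming functionals
and their ratio attains a maximum on each subspace. -/
theorem exists_common_splitting [FiniteDimensional K V] (hN : IsUltraNorm abv N)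
    (hN' : IsUltraNorm abv N')
    (hφ : ∀ v ≠ 0, ∃ φ : V →ₗ[K] K, φ v = 1 ∧ ∀ w, abv (φ w) * N v ≤ N w)
    (hmax : ∀ W : Submodule K V, W ≠ ⊥ →
      ∃ v ∈ W, v ≠ 0 ∧ ∀ w ∈ W, N w * N' v ≤ N v * N' w)
    {n : ℕ} (hn : Module.finrank K V = n) :
    ∃ f : Module.Basis (Fin n) K V, Splits abv f N ∧ Splits abv f N' := by
  have H : ∀ (n : ℕ) (W : Submodule K V), Module.finrank K W = n →
      ∃ f : Fin n → V, (∀ i, f i ∈ W) ∧ (∀ i, f i ≠ 0) ∧ ∀ w ∈ W, ∃ a : Fin n → K,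
        w = ∑ i, a i • f i ∧ ∀ i, abv (a i) * N (f i) ≤ N w ∧ abv (a i) * N' (f i) ≤ N' w := by
    intro n
    induction n with
    | zero =>
      intro W hW
      rw [Submodule.finrank_eq_zero] at hW
      subst hW
      exact ⟨Fin.elim0, fun i => i.elim0, fun i => i.elim0,
        fun w hw => ⟨Fin.elim0, by simpa using hw, fun i => i.elim0⟩⟩
    | succ n ih =>
      intro W hW
      have hWb : W ≠ ⊥ := by rintro rfl; simp at hW
      obtain ⟨v, hvW, hv, hm⟩ := hmax W hWb
      obtain ⟨φ, hφv, hφ⟩ := hφ v hv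
      -- Since N / N' is maximal at `v` on `W`, a functional norming `v` for `N` also norms it for
      -- `N'`. Hence `W` is the sum of the line of `v` and of `W ⊓ ker φ`, orthogonally for both
      -- norms.
      have hφ' : ∀ w ∈ W, abv (φ w) * N' v ≤ N' w := fun w hw => by
        have h1 := hm w hw
        have h2 := mul_le_mul_of_nonneg_right (hφ w) (hN'.nonneg v)
        have hpos := hN.pos v hv
        refine le_of_mul_le_mul_left ?_ hpos
        linarith
      have hker : Module.finrank K (W ⊓ LinearMap.ker φ : Submodule K V) = n := by
        have h1 := LinearMap.finrank_range_add_finrank_ker (φ.domRestrict W)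
        have h2 : LinearMap.range (φ.domRestrict W) = ⊤ := by
          refine LinearMap.range_eq_top.2 fun c => ⟨c • ⟨v, hvW⟩, ?_⟩
          simp [hφv]
        have h3 : Module.finrank K (LinearMap.ker (φ.domRestrict W)) =
            Module.finrank K (W ⊓ LinearMap.ker φ : Submodule K V) := by
          have : (LinearMap.ker (φ.domRestrict W)).map W.subtype = W ⊓ LinearMap.ker φ := by
            ext x
            simp only [Submodule.mem_map, LinearMap.mem_ker, Submodule.mem_inf]
            exact ⟨fun ⟨y, hy, hyx⟩ => hyx ▸ ⟨y.2, hy⟩, fun ⟨h, h'⟩ => ⟨⟨x, h⟩, h', rfl⟩⟩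
          rw [← this]
          exact (LinearEquiv.finrank_eq (Submodule.equivMapOfInjective _
            W.injective_subtype _))
        rw [h2, finrank_top, Module.finrank_self, h3, hW] at h1
        omega
      obtain ⟨f, hfW, hf0, hf⟩ := ih _ hker
      refine ⟨Fin.cons v f, fun i => ?_, fun i => ?_, fun w hw => ?_⟩
      · refine Fin.cases hvW (fun i => (hfW i).1) i
      · refine Fin.cases hv hf0 i
      · have hw' : w - φ w • v ∈ W ⊓ LinearMap.ker φ :=
          ⟨sub_mem hw (W.smul_mem _ hvW), by simp [hφv]⟩
        obtain ⟨a, ha, hb⟩ := hf _ hw'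
        have h1 : N (w - φ w • v) ≤ N w := (hN.sub_le _ _).trans
          (max_le le_rfl ((hN.smul _ _).trans_le (hφ w)))
        have h2 : N' (w - φ w • v) ≤ N' w := (hN'.sub_le _ _).trans
          (max_le le_rfl ((hN'.smul _ _).trans_le (hφ' w hw)))
        refine ⟨Fin.cons (φ w) a, ?_, fun i => ?_⟩
        · rw [Fin.sum_univ_succ]
          simp only [Fin.cons_zero, Fin.cons_succ]
          rw [← ha, add_sub_cancel]
        · refine Fin.cases ⟨hφ w, hφ' w hw⟩ (fun i => ?_) i
          simp only [Fin.cons_succ]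
          exact ⟨(hb i).1.trans h1, (hb i).2.trans h2⟩
  obtain ⟨f, -, -, hf⟩ := H n ⊤ (by rw [finrank_top, hn])
  have hspan : ⊤ ≤ Submodule.span K (Set.range f) := fun w _ => by
    obtain ⟨a, rfl, -⟩ := hf w trivial
    exact sum_mem fun i _ => Submodule.smul_mem _ _ (Submodule.subset_span ⟨i, rfl⟩)
  have hli : LinearIndependent K f :=
    linearIndependent_of_top_le_span_of_card_eq_finrank hspan (by simp [hn])
  let b := Module.Basis.mk hli hspan
  have hb : ∀ w i, abv (b.repr w i) * N (b i) ≤ N w ∧ abv (b.repr w i) * N' (b i) ≤ N' w := by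
    intro w i
    obtain ⟨a, ha, h⟩ := hf w trivial
    have : b.repr w i = a i := by
      have hw : w = ∑ i, a i • b i := by rw [ha]; simp [b]
      rw [hw, b.repr_sum_self]
    rw [this, Module.Basis.mk_apply]
    exact h i
  exact ⟨b, fun w i => (hb w i).1, fun w i => (hb w i).2⟩

end CommonSplitting

section

variable {O K : Type*} [CommRing O] [Field K] [Algebra O K]

lemma algebraMap_uniformizer_ne_zero [IsFractionRing O K] {ϖ : O} (hϖ : Irreducible ϖ) :
    algebraMap O K ϖ ≠ 0 :=
  (map_ne_zero_iff _ (IsFractionRing.injective O K)).mpr hϖ.ne_zero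

lemma mem_smul_iff {d : ℕ} {c : K} (hc : c ≠ 0) (L : Submodule O (Fin (d + 1) → K))
    {v : Fin (d + 1) → K} : v ∈ c • L ↔ c⁻¹ • v ∈ L := by
  rw [Submodule.mem_smul_pointwise_iff_exists]
  exact ⟨fun ⟨w, hw, h⟩ => by rwa [← h, inv_smul_smul₀ hc], fun h => ⟨_, h, smul_inv_smul₀ hc v⟩⟩

end

/-! ### The absolute value of the discrete valuation ring -/

section AbsoluteValue

variable (O K : Type*) [CommRing O] [IsDomain O] [IsDiscreteValuationRing O] [Field K] [Algebra O K]
  [IsFractionRing O K]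

/-- The absolute value of the fraction field of a discrete valuation ring for which uniformizers
have absolute value `exp (-1)`. -/
def dvrAbv : AbsoluteValue K ℝ :=
  (IsDiscreteValuationRing.maximalIdeal O).adicAbv (K := K) (b := (Real.exp 1).toNNReal)
    (Real.one_lt_toNNReal.2 (by simp))

lemma isNonarchimedean_dvrAbv : IsNonarchimedean (dvrAbv O K) :=
  IsDedekindDomain.HeightOneSpectrum.isNonarchimedean_adicAbv _ _

variable {O K}

lemma dvrAbv_unit (u : Oˣ) : dvrAbv O K (algebraMap O K u) = 1 := by
  rw [dvrAbv, IsDedekindDomain.HeightOneSpectrum.adicAbv_coe_eq_one_iff]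
  exact fun h => (IsLocalRing.mem_maximalIdeal _).1 h u.isUnit

lemma dvrAbv_algebraMap_le_one (a : O) : dvrAbv O K (algebraMap O K a) ≤ 1 :=
  IsDedekindDomain.HeightOneSpectrum.adicAbv_coe_le_one _ _ _

lemma dvrAbv_uniformizer {ϖ : O} (hϖ : Irreducible ϖ) :
    dvrAbv O K (algebraMap O K ϖ) = Real.exp (-1) := by
  have h1 : (IsDiscreteValuationRing.maximalIdeal O).valuation K (algebraMap O K ϖ) =
      WithZero.exp (-1 : ℤ) := by
    rw [IsDedekindDomain.HeightOneSpectrum.valuation_of_algebraMap]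
    exact IsDedekindDomain.HeightOneSpectrum.intValuation_singleton _ hϖ.ne_zero
      hϖ.maximalIdeal_eq
  change ((WithZeroMulInt.toNNReal (e := (Real.exp 1).toNNReal) (by simp [Real.exp_pos])
    ((IsDiscreteValuationRing.maximalIdeal O).valuation K (algebraMap O K ϖ)) : NNReal) : ℝ) = _
  rw [h1, WithZeroMulInt.toNNReal_neg_apply _ (by simp)]
  rw [NNReal.coe_zpow, Real.coe_toNNReal _ (Real.exp_pos 1).le, Real.exp_neg]
  exact zpow_neg_one _

lemma dvrAbv_uniformizer_zpow {ϖ : O} (hϖ : Irreducible ϖ) (n : ℤ) :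
    dvrAbv O K (algebraMap O K ϖ ^ n) = Real.exp (-n) := by
  rw [map_zpow₀, dvrAbv_uniformizer hϖ, ← Real.rpow_intCast, ← Real.exp_mul]
  simp

lemma exists_eq_unit_mul_zpow {ϖ : O} (hϖ : Irreducible ϖ) {a : K} (ha : a ≠ 0) :
    ∃ (n : ℤ) (u : Oˣ), a = algebraMap O K u * algebraMap O K ϖ ^ n := by
  obtain ⟨n, u, h⟩ :=
    IsDiscreteValuationRing.exists_units_eq_smul_zpow_of_irreducible (K := K) hϖ ha
  exact ⟨n, u, by rw [h, Units.smul_def, Algebra.smul_def]⟩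

lemma exists_dvrAbv_eq_exp {a : K} (ha : a ≠ 0) : ∃ n : ℤ, dvrAbv O K a = Real.exp n := by
  obtain ⟨ϖ, hϖ⟩ := IsDiscreteValuationRing.exists_irreducible O
  obtain ⟨n, u, rfl⟩ := exists_eq_unit_mul_zpow hϖ ha
  exact ⟨-n, by rw [map_mul, dvrAbv_unit, one_mul, dvrAbv_uniformizer_zpow hϖ]; simp⟩

lemma dvrAbv_le_one_iff {a : K} : dvrAbv O K a ≤ 1 ↔ a ∈ Set.range (algebraMap O K) := by
  refine ⟨fun h => ?_, fun ⟨b, hb⟩ => hb ▸ dvrAbv_algebraMap_le_one b⟩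
  rcases eq_or_ne a 0 with rfl | ha
  · exact ⟨0, map_zero _⟩
  obtain ⟨ϖ, hϖ⟩ := IsDiscreteValuationRing.exists_irreducible O
  obtain ⟨n, u, rfl⟩ := exists_eq_unit_mul_zpow hϖ ha
  rw [map_mul, dvrAbv_unit, one_mul, dvrAbv_uniformizer_zpow hϖ, Real.exp_le_one_iff] at h
  have hn : 0 ≤ n := by
    have : (0 : ℝ) ≤ n := by linarith
    exact_mod_cast this
  lift n to ℕ using hn
  exact ⟨u * ϖ ^ n, by simp⟩

end AbsoluteValue

/-! ### Lattices as integral norms -/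

section LatticeNorm

variable {O K : Type*} [CommRing O] [IsDomain O] [IsDiscreteValuationRing O] [Field K] [Algebra O K]
  [IsFractionRing O K] {d : ℕ}

lemma Lattice.exists_basis (L : Lattice O K d) :
    ∃ b : Module.Basis (Fin (d + 1)) K (Fin (d + 1) → K), basisLattice b = L := by
  obtain ⟨L, hL⟩ := L
  let b₀ := Module.finBasisOfFinrankEq O L
    ((Submodule.IsLattice.finrank_of_pi K L).trans (Fintype.card_fin _))
  refine ⟨b₀.extendOfIsLattice K, Subtype.ext ?_⟩
  change Submodule.span O (Set.range _) = L
  have : (Set.range (b₀.extendOfIsLattice K)) = L.subtype '' Set.range b₀ := by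
    rw [← Set.range_comp]; congr 1; ext1 i; simp
  rw [this, ← Submodule.map_span, b₀.span_eq, Submodule.map_top, Submodule.range_subtype]

/-- The norm on `K^{d+1}` whose unit ball is the lattice `L`. -/
def latticeNorm (L : Lattice O K d) : (Fin (d + 1) → K) → ℝ :=
  splitNorm (dvrAbv O K) L.exists_basis.choose 0

lemma isUltraNorm_latticeNorm (L : Lattice O K d) : IsUltraNorm (dvrAbv O K) (latticeNorm L) :=
  isUltraNorm_splitNorm (isNonarchimedean_dvrAbv O K) _ _

lemma mem_basisLattice_iff (b : Module.Basis (Fin (d + 1)) K (Fin (d + 1) → K))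
    {v : Fin (d + 1) → K} :
    v ∈ (basisLattice (O := O) b).1 ↔ splitNorm (dvrAbv O K) b 0 v ≤ 1 := by
  rw [splitNorm_le_iff zero_le_one]
  change v ∈ Submodule.span O (Set.range b) ↔ _
  rw [b.mem_span_iff_repr_mem O]
  simp [dvrAbv_le_one_iff]

lemma mem_iff_latticeNorm_le_one (L : Lattice O K d) {v : Fin (d + 1) → K} :
    v ∈ L.1 ↔ latticeNorm L v ≤ 1 := by
  rw [latticeNorm, ← mem_basisLattice_iff, L.exists_basis.choose_spec]

/-- A norm is integral if its nonzero values are integral powers of `exp 1`. -/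
def IsIntegralNorm {V : Type*} [Zero V] (N : V → ℝ) : Prop :=
  ∀ v, v ≠ 0 → ∃ n : ℤ, N v = Real.exp n

lemma isIntegralNorm_splitNorm (b : Module.Basis (Fin (d + 1)) K (Fin (d + 1) → K))
    (α : Fin (d + 1) → ℤ) : IsIntegralNorm (splitNorm (dvrAbv O K) b fun i => (α i : ℝ)) := by
  intro v hv
  have hN := isUltraNorm_splitNorm (isNonarchimedean_dvrAbv O K) b fun i => (α i : ℝ)
  obtain ⟨i, hi⟩ := hN.exists_repr b hv
  have h := le_antisymm hi (splits_splitNorm _ b _ v i)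
  have hne : b.repr v i ≠ 0 := fun h0 => by
    rw [h0, map_zero, zero_mul] at h; exact (hN.pos v hv).ne' h
  obtain ⟨n, hn⟩ := exists_dvrAbv_eq_exp (O := O) hne
  exact ⟨n + α i, by rw [h, hn, splitNorm_basis, ← Real.exp_add]; simp⟩

lemma isIntegralNorm_latticeNorm (L : Lattice O K d) : IsIntegralNorm (latticeNorm L) := by
  have := isIntegralNorm_splitNorm (O := O) L.exists_basis.choose 0
  simpa [latticeNorm, Pi.zero_def] using this

/-- Integrality allows every nonzero vector to be rescaled to norm exactly 1, so nothing is lost in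
passing from the unit ball to all vectors. -/
lemma IsIntegralNorm.le_of_ball {V : Type*} [AddCommGroup V] [Module K V] {N N' : V → ℝ}
    (hi : IsIntegralNorm N) (hN : IsUltraNorm (dvrAbv O K) N) (hN' : IsUltraNorm (dvrAbv O K) N')
    {C : ℝ} (h : ∀ v, N v ≤ 1 → N' v ≤ C) (v : V) : N' v ≤ C * N v := by
  rcases eq_or_ne v 0 with rfl | hv
  · simp [hN.map_zero, hN'.map_zero]
  obtain ⟨n, hn⟩ := hi v hv
  obtain ⟨ϖ, hϖ⟩ := IsDiscreteValuationRing.exists_irreducible O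
  have h1 := h ((algebraMap O K ϖ ^ n) • v) (by
    rw [hN.smul, dvrAbv_uniformizer_zpow hϖ, hn, ← Real.exp_add]; simp)
  rw [hN'.smul, dvrAbv_uniformizer_zpow hϖ, Real.exp_neg, inv_mul_le_iff₀ (Real.exp_pos _)] at h1
  rw [hn, mul_comm]
  exact h1

lemma latticeNorm_le_of_le {L M : Lattice O K d} (h : L.1 ≤ M.1) (v : Fin (d + 1) → K) :
    latticeNorm M v ≤ latticeNorm L v := by
  have := (isIntegralNorm_latticeNorm L).le_of_ball (isUltraNorm_latticeNorm L)
    (isUltraNorm_latticeNorm M) (C := 1) (fun v hv => (mem_iff_latticeNorm_le_one M).1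
      (h ((mem_iff_latticeNorm_le_one L).2 hv))) v
  rwa [one_mul] at this

lemma latticeNorm_le_of_uniformizer_smul_le {ϖ : O} (hϖ : Irreducible ϖ) {L M : Lattice O K d}
    (h : ϖ • L.1 ≤ M.1) (v : Fin (d + 1) → K) :
    latticeNorm M v ≤ Real.exp 1 * latticeNorm L v := by
  refine (isIntegralNorm_latticeNorm L).le_of_ball (isUltraNorm_latticeNorm L)
    (isUltraNorm_latticeNorm M) (fun v hv => ?_) v
  have h1 := (mem_iff_latticeNorm_le_one M).1 (h (Submodule.smul_mem_pointwise_smul v ϖ _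
    ((mem_iff_latticeNorm_le_one L).2 hv)))
  rw [← algebraMap_smul K ϖ v, (isUltraNorm_latticeNorm M).smul, dvrAbv_uniformizer hϖ,
    Real.exp_neg, inv_mul_le_iff₀ (Real.exp_pos _), mul_one] at h1
  exact h1

lemma latticeNorm_eq_of_ball {L : Lattice O K d} {N : (Fin (d + 1) → K) → ℝ}
    (hi : IsIntegralNorm N) (hN : IsUltraNorm (dvrAbv O K) N)
    (h : ∀ v, N v ≤ 1 ↔ v ∈ L.1) : latticeNorm L = N := by
  ext v
  refine le_antisymm ?_ ?_
  · have := hi.le_of_ball hN (isUltraNorm_latticeNorm L) (C := 1)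
      (fun v hv => (mem_iff_latticeNorm_le_one L).1 ((h v).1 hv)) v
    rwa [one_mul] at this
  · have := (isIntegralNorm_latticeNorm L).le_of_ball (isUltraNorm_latticeNorm L) hN (C := 1)
      (fun v hv => (h v).2 ((mem_iff_latticeNorm_le_one L).2 hv)) v
    rwa [one_mul] at this

lemma exists_latticeNorm_eq_exp_mul {L M : Lattice O K d} (h : L.toVertex = M.toVertex) :
    ∃ k : ℤ, ∀ v, latticeNorm M v = Real.exp k * latticeNorm L v := by
  obtain ⟨c, hc, hM⟩ : ∃ c : K, c ≠ 0 ∧ M.1 = c • L.1 := Quotient.exact h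
  obtain ⟨k, hk⟩ := exists_dvrAbv_eq_exp (O := O) (inv_ne_zero hc)
  refine ⟨k, fun v => ?_⟩
  rw [latticeNorm_eq_of_ball (L := M) (N := fun v => Real.exp k * latticeNorm L v)]
  · intro v hv
    obtain ⟨n, hn⟩ := isIntegralNorm_latticeNorm L v hv
    exact ⟨k + n, by simp only [hn]; rw [← Real.exp_add]; simp⟩
  · exact (isUltraNorm_latticeNorm L).const_mul (Real.exp_pos _)
  · intro v
    rw [hM, mem_smul_iff hc, mem_iff_latticeNorm_le_one, (isUltraNorm_latticeNorm L).smul, hk]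

/-- The values being discrete, the radius may be rounded down to exp ⌊log r⌋, and that ball is `L`
times a power of the uniformizer. -/
lemma toVertex_eq_of_mem_iff {L M : Lattice O K d} {r : ℝ} (hr : 0 < r)
    (h : ∀ v, v ∈ M.1 ↔ latticeNorm L v ≤ r) : L.toVertex = M.toVertex := by
  obtain ⟨ϖ, hϖ⟩ := IsDiscreteValuationRing.exists_irreducible O
  have hϖ' := algebraMap_uniformizer_ne_zero (K := K) hϖ
  set k := ⌊Real.log r⌋ with hk
  refine Quotient.sound ⟨algebraMap O K ϖ ^ (-k), zpow_ne_zero _ hϖ', ?_⟩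
  ext v
  rw [mem_smul_iff (zpow_ne_zero _ hϖ'), mem_iff_latticeNorm_le_one L, ← zpow_neg, neg_neg, h,
    (isUltraNorm_latticeNorm L).smul, dvrAbv_uniformizer_zpow hϖ]
  rcases eq_or_ne v 0 with rfl | hv
  · simp [(isUltraNorm_latticeNorm L).map_zero, hr.le]
  obtain ⟨n, hn⟩ := isIntegralNorm_latticeNorm L v hv
  rw [hn, ← Real.exp_add, Real.exp_le_one_iff, ← Real.le_log_iff_exp_le hr, ← Int.le_floor, ← hk,
    neg_add_le_iff_le_add, add_zero, Int.cast_le]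

/-- The vector ϖ^{αᵢ} fᵢ has norm 1 and |ϖ| = exp(-1), so log N(fᵢ) = αᵢ: the normalization makes
logarithmic coordinates equal to those of the apartment. -/
lemma latticeNorm_basisLattice_scaledBasis {ϖ : O} (hϖ : Irreducible ϖ)
    (f : Module.Basis (Fin (d + 1)) K (Fin (d + 1) → K)) (α : Fin (d + 1) → ℤ) :
    latticeNorm (basisLattice (O := O) (scaledBasis ϖ hϖ f α)) =
      splitNorm (dvrAbv O K) f fun i => (α i : ℝ) := by
  refine latticeNorm_eq_of_ball (O := O) (isIntegralNorm_splitNorm f α)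
    (isUltraNorm_splitNorm (isNonarchimedean_dvrAbv O K) _ _) fun v => ?_
  rw [mem_basisLattice_iff (O := O), splitNorm_le_iff zero_le_one, splitNorm_le_iff zero_le_one]
  refine forall_congr' fun i => ?_
  have hϖ' := algebraMap_uniformizer_ne_zero (K := K) hϖ
  have : (scaledBasis ϖ hϖ f α).repr v i = (algebraMap O K ϖ) ^ (-α i) * f.repr v i := by
    rw [scaledBasis, Module.Basis.repr_unitsSMul, Units.smul_def, Units.val_inv_eq_inv_val,
      Units.val_zpow_eq_zpow_val, Units.val_mk0, zpow_neg, smul_eq_mul]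
  rw [this, map_mul, dvrAbv_uniformizer_zpow hϖ]
  simp [mul_comm]

end LatticeNorm

/-! ### The norm attached to a point of the building -/

section PointNorm

section

variable {O K : Type*} [CommRing O] [Field K] [Algebra O K] {d : ℕ} {ϖ : O}

/-- A lattice representing a vertex. -/
def Vertex.rep (s : Vertex O K d) : Lattice O K d := Quotient.out (s := homothety O K d) s

lemma Vertex.toVertex_rep (s : Vertex O K d) : s.rep.toVertex = s := Quotient.out_eq _

lemma Realization.sum_weight (x : Realization K d ϖ) : ∑ s ∈ x.weight.support, x.weight s = 1 :=
  x.sum_eq_one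

lemma Realization.weight_pos (x : Realization K d ϖ) {s : Vertex O K d}
    (hs : s ∈ x.weight.support) : 0 < x.weight s :=
  lt_of_le_of_ne (x.nonneg s) (Finsupp.mem_support_iff.1 hs).symm

lemma IsSimplex.exists_lattices {σ : Set (Vertex O K d)} (h : IsSimplex ϖ σ) :
    ∃ L : Vertex O K d → Lattice O K d, (∀ s ∈ σ, (L s).toVertex = s) ∧ ∀ s ∈ σ, ∀ t ∈ σ,
      ((L s).1 ≤ (L t).1 ∧ ϖ • (L t).1 ≤ (L s).1) ∨
        ((L t).1 ≤ (L s).1 ∧ ϖ • (L s).1 ≤ (L t).1) := by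
  obtain ⟨k, M, hM, hlt, rfl⟩ := h
  have hch : ∀ i j, i ≤ j → (M i).1 ≤ (M j).1 ∧ ϖ • (M j).1 ≤ (M i).1 := fun i j hij =>
    ⟨hM.monotone hij, (smul_mono_right ϖ (hM.monotone (Fin.le_last j))).trans
      (hlt.le.trans (hM.monotone (Fin.zero_le i)))⟩
  have hex : ∀ s : Vertex O K d, ∃ i : Fin (k + 1),
      s ∈ Set.range (fun i => (M i).toVertex) → (M i).toVertex = s := fun s => by
    by_cases hs : s ∈ Set.range fun i => (M i).toVertex
    · obtain ⟨i, hi⟩ := hs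
      exact ⟨i, fun _ => hi⟩
    · exact ⟨0, fun h => absurd h hs⟩
  choose j hj using hex
  refine ⟨fun s => M (j s), hj, fun s _ t _ => ?_⟩
  rcases le_total (j s) (j t) with h | h
  · exact Or.inl (hch _ _ h)
  · exact Or.inr (hch _ _ h)

end

variable {O K : Type*} [CommRing O] [IsDomain O] [IsDiscreteValuationRing O] [Field K] [Algebra O K]
  [IsFractionRing O K] {d : ℕ}

/-- The logarithm of the norm of a lattice. -/
def latticeLog (L : Lattice O K d) (v : Fin (d + 1) → K) : ℤ := ⌊Real.log (latticeNorm L v)⌋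

lemma log_latticeNorm (L : Lattice O K d) {v : Fin (d + 1) → K} (hv : v ≠ 0) :
    Real.log (latticeNorm L v) = latticeLog L v := by
  obtain ⟨n, hn⟩ := isIntegralNorm_latticeNorm L v hv
  simp [latticeLog, hn]

lemma latticeNorm_eq_exp (L : Lattice O K d) {v : Fin (d + 1) → K} (hv : v ≠ 0) :
    latticeNorm L v = Real.exp (latticeLog L v) := by
  rw [← log_latticeNorm L hv, Real.exp_log ((isUltraNorm_latticeNorm L).pos v hv)]

lemma mem_iff_latticeLog_nonpos (L : Lattice O K d) {v : Fin (d + 1) → K} (hv : v ≠ 0) :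
    v ∈ L.1 ↔ latticeLog L v ≤ 0 := by
  rw [mem_iff_latticeNorm_le_one, latticeNorm_eq_exp L hv, Real.exp_le_one_iff, Int.cast_nonpos]

lemma latticeLog_le {L M : Lattice O K d} (h : L.1 ≤ M.1) {v : Fin (d + 1) → K} (hv : v ≠ 0) :
    latticeLog M v ≤ latticeLog L v := by
  have := latticeNorm_le_of_le h v
  rwa [latticeNorm_eq_exp L hv, latticeNorm_eq_exp M hv, Real.exp_le_exp, Int.cast_le] at this

lemma latticeLog_le_add_one {ϖ : O} (hϖ : Irreducible ϖ) {L M : Lattice O K d}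
    (h : ϖ • L.1 ≤ M.1) {v : Fin (d + 1) → K} (hv : v ≠ 0) :
    latticeLog M v ≤ latticeLog L v + 1 := by
  have := latticeNorm_le_of_uniformizer_smul_le hϖ h v
  rw [latticeNorm_eq_exp L hv, latticeNorm_eq_exp M hv, ← Real.exp_add, Real.exp_le_exp] at this
  have h2 : ((latticeLog M v : ℤ) : ℝ) ≤ ((latticeLog L v + 1 : ℤ) : ℝ) := by push_cast; linarith
  exact_mod_cast h2

/-- Two lattices `L ⊆ M` with `ϖ M ⊆ L`, expressed by their norms. -/
def LogClose (L M : Lattice O K d) : Prop :=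
  ∀ v : Fin (d + 1) → K, v ≠ 0 → latticeLog M v ≤ latticeLog L v ∧
    latticeLog L v ≤ latticeLog M v + 1

lemma logClose_of_le {ϖ : O} (hϖ : Irreducible ϖ) {L M : Lattice O K d}
    (h : L.1 ≤ M.1 ∧ ϖ • M.1 ≤ L.1) : LogClose L M := fun _ hv =>
  ⟨latticeLog_le h.1 hv, latticeLog_le_add_one hϖ h.2 hv⟩

lemma IsSimplex.exists_logClose {ϖ : O} (hϖ : Irreducible ϖ) {σ : Set (Vertex O K d)}
    (h : IsSimplex ϖ σ) :
    ∃ L : Vertex O K d → Lattice O K d, (∀ s ∈ σ, (L s).toVertex = s) ∧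
      ∀ s ∈ σ, ∀ t ∈ σ, LogClose (L s) (L t) ∨ LogClose (L t) (L s) := by
  obtain ⟨L, h1, h2⟩ := h.exists_lattices
  exact ⟨L, h1, fun s hs t ht => (h2 s hs t ht).imp (logClose_of_le hϖ) (logClose_of_le hϖ)⟩

variable {ϖ : O}

/-- The norm on `K^{d+1}`, well defined up to a positive factor, attached to a point of the
building: the geometric mean of the norms of the lattices of its vertices. -/
def pointNorm (x : Realization K d ϖ) (v : Fin (d + 1) → K) : ℝ :=
  open Classical in
  if v = 0 then 0 else
    Real.exp (∑ s ∈ x.weight.support, x.weight s * Real.log (latticeNorm s.rep v))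

lemma pointNorm_zero (x : Realization K d ϖ) : pointNorm x 0 = 0 := by simp [pointNorm]

lemma pointNorm_pos (x : Realization K d ϖ) {v : Fin (d + 1) → K} (hv : v ≠ 0) :
    0 < pointNorm x v := by
  rw [pointNorm, if_neg hv]; exact Real.exp_pos _

lemma log_pointNorm (x : Realization K d ϖ) {v : Fin (d + 1) → K} (hv : v ≠ 0) :
    Real.log (pointNorm x v) =
      ∑ s ∈ x.weight.support, x.weight s * Real.log (latticeNorm s.rep v) := by
  rw [pointNorm, if_neg hv, Real.log_exp]

/-- Changing representatives adds a constant to each log norm. The arbitrary `s.rep` can thus be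
replaced by lattices forming a chain, or adapted to an apartment. -/
lemma exists_log_pointNorm_eq (x : Realization K d ϖ) {L : Vertex O K d → Lattice O K d}
    (hL : ∀ s ∈ x.weight.support, (L s).toVertex = s) : ∃ k : ℝ, ∀ v : Fin (d + 1) → K, v ≠ 0 →
      Real.log (pointNorm x v) =
        k + ∑ s ∈ x.weight.support, x.weight s * Real.log (latticeNorm (L s) v) := by
  have : ∀ s, ∃ k : ℤ, s ∈ x.weight.support →
      ∀ v, latticeNorm s.rep v = Real.exp k * latticeNorm (L s) v := fun s => by
    by_cases hs : s ∈ x.weight.support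
    · obtain ⟨k, hk⟩ := exists_latticeNorm_eq_exp_mul (L := L s) (M := s.rep)
        ((hL s hs).trans s.toVertex_rep.symm)
      exact ⟨k, fun _ => hk⟩
    · exact ⟨0, fun h => absurd h hs⟩
  choose k hk using this
  refine ⟨∑ s ∈ x.weight.support, x.weight s * k s, fun v hv => ?_⟩
  rw [log_pointNorm x hv, ← Finset.sum_add_distrib]
  refine Finset.sum_congr rfl fun s hs => ?_
  rw [hk s hs, Real.log_mul (Real.exp_pos _).ne' ((isUltraNorm_latticeNorm _).pos v hv).ne',
    Real.log_exp, mul_add]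

/-- A geometric mean of ultrametric norms need not be ultrametric; the simplex condition is what
makes it so. The integral log norms of two lattices of the chain differ by 0 or 1 in a fixed
direction, so if `w` is strictly smaller than `v` for one lattice it is at most `v` for all of them.
Homogeneity holds because the weights sum to 1. -/
lemma isUltraNorm_pointNorm (hϖ : Irreducible ϖ) (x : Realization K d ϖ) :
    IsUltraNorm (dvrAbv O K) (pointNorm x) where
  smul a v := by
    rcases eq_or_ne a 0 with rfl | ha
    · simp [pointNorm_zero]
    rcases eq_or_ne v 0 with rfl | hv
    · simp [pointNorm_zero]
    have hav : a • v ≠ 0 := smul_ne_zero ha hv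
    have ha' := (dvrAbv O K).pos ha
    rw [← Real.exp_log (pointNorm_pos x hav), ← Real.exp_log (pointNorm_pos x hv),
      ← Real.exp_log ha', ← Real.exp_add, log_pointNorm x hv, log_pointNorm x hav,
      ← one_mul (Real.log (dvrAbv O K a)), ← x.sum_weight, Finset.sum_mul,
      ← Finset.sum_add_distrib]
    refine congrArg _ (Finset.sum_congr rfl fun s _ => ?_)
    rw [(isUltraNorm_latticeNorm _).smul, Real.log_mul ha'.ne'
      ((isUltraNorm_latticeNorm _).pos v hv).ne', mul_add]
  add_le v w := by
    rcases eq_or_ne v 0 with rfl | hv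
    · simp
    rcases eq_or_ne w 0 with rfl | hw
    · simp
    rcases eq_or_ne (v + w) 0 with hvw | hvw
    · rw [hvw, pointNorm_zero]; exact le_max_of_le_left (pointNorm_pos x hv).le
    obtain ⟨L, hL, hc⟩ := x.isSimplex_support.exists_logClose hϖ
    obtain ⟨k, hk⟩ := exists_log_pointNorm_eq x hL
    have hmono : ∀ v w : Fin (d + 1) → K, v ≠ 0 → w ≠ 0 → v + w ≠ 0 →
        (∀ s ∈ x.weight.support, latticeLog (L s) v ≤ latticeLog (L s) w) →
        pointNorm x (v + w) ≤ pointNorm x w := by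
      intro v w hv hw hvw h
      rw [← Real.log_le_log_iff (pointNorm_pos x hvw) (pointNorm_pos x hw), hk _ hvw, hk _ hw]
      refine add_le_add_right (Finset.sum_le_sum fun s hs =>
        mul_le_mul_of_nonneg_left ?_ (x.nonneg s)) _
      refine Real.log_le_log ((isUltraNorm_latticeNorm _).pos _ hvw)
        (((isUltraNorm_latticeNorm _).add_le v w).trans (max_le ?_ le_rfl))
      rw [latticeNorm_eq_exp _ hv, latticeNorm_eq_exp _ hw]
      exact Real.exp_le_exp.2 (Int.cast_le.2 (h s hs))
    by_cases h : ∀ s ∈ x.weight.support, latticeLog (L s) v ≤ latticeLog (L s) w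
    · exact le_max_of_le_right (hmono v w hv hw hvw h)
    · push Not at h
      obtain ⟨s, hs, hlt⟩ := h
      refine le_max_of_le_left ?_
      rw [add_comm v w] at hvw ⊢
      refine hmono w v hw hv hvw fun t ht => ?_
      rcases hc s hs t ht with h | h
      · have h1 := h v hv; have h2 := h w hw; omega
      · have h1 := h v hv; have h2 := h w hw; omega
  pos v hv := pointNorm_pos x hv

/-- The lattices of the vertices of the support of `x` are balls for the norm of `x`. -/
lemma exists_ball_of_mem_support (hϖ : Irreducible ϖ) (x : Realization K d ϖ) {s : Vertex O K d}
    (hs : s ∈ x.weight.support) : ∃ (M : Lattice O K d) (r : ℝ), 0 < r ∧ M.toVertex = s ∧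
      ∀ v, v ∈ M.1 ↔ pointNorm x v ≤ r := by
  classical
  obtain ⟨L, hL, hc⟩ := x.isSimplex_support.exists_logClose hϖ
  obtain ⟨k, hk⟩ := exists_log_pointNorm_eq x hL
  -- `e t` separates the two cases: log norm at most 0 at `s` forces at most `e t` at `t`, and at
  -- least 1 at `s` forces at least `e t` at `t`. The clause `t ≠ s` gives `e s = 0`, hence a strict
  -- inequality at `s`, whose weight is positive.
  let e : Vertex O K d → ℤ := fun t => if t ≠ s ∧ LogClose (L t) (L s) then 1 else 0
  refine ⟨L s, Real.exp (k + ∑ t ∈ x.weight.support, x.weight t * e t), Real.exp_pos _, hL s hs,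
    fun v => ?_⟩
  rcases eq_or_ne v 0 with rfl | hv
  · simp [pointNorm_zero, (Real.exp_pos _).le]
  rw [mem_iff_latticeLog_nonpos _ hv, ← Real.log_le_iff_le_exp (pointNorm_pos x hv), hk v hv,
    add_le_add_iff_left]
  simp_rw [log_latticeNorm _ hv]
  constructor
  · intro h
    refine Finset.sum_le_sum fun t ht => mul_le_mul_of_nonneg_left (Int.cast_le.2 ?_) (x.nonneg t)
    by_cases hts : t = s
    · simp [e, hts, h]
    · by_cases hB : LogClose (L t) (L s)
      · have := hB v hv
        simp only [e, ne_eq, hts, not_false_eq_true, hB, and_self, if_true]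
        omega
      · have := ((hc t ht s hs).resolve_left hB) v hv
        simp only [e, hB, and_false, if_false]
        omega
  · intro h
    by_contra hcon
    refine h.not_gt (Finset.sum_lt_sum (fun t ht => mul_le_mul_of_nonneg_left (Int.cast_le.2 ?_)
      (x.nonneg t)) ⟨s, hs, mul_lt_mul_of_pos_left (Int.cast_lt.2 ?_) (x.weight_pos hs)⟩)
    · by_cases hts : t = s
      · simp only [e, hts, ne_eq, not_true, false_and, if_false]
        omega
      · by_cases hB : LogClose (L t) (L s)
        · have := hB v hv
          simp only [e, ne_eq, hts, not_false_eq_true, hB, and_self, if_true]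
          omega
        · have := ((hc t ht s hs).resolve_left hB) v hv
          simp only [e, hB, and_false, if_false]
          omega
    · simp only [e, ne_eq, not_true, false_and, if_false]
      omega

end PointNorm

/-! ### Apartments as sets of norms split by a basis -/

section Coordinates

variable {O K : Type*} [CommRing O] [IsDomain O] [IsDiscreteValuationRing O] [Field K] [Algebra O K]
  [IsFractionRing O K] {d : ℕ} {ϖ : O}

/-- The class of a vector in `ℝ^{d+1} / ℝ·(1, …, 1)`. -/
def modelPoint (a : Fin (d + 1) → ℝ) : ModelSpace d :=
  Submodule.Quotient.mk (WithLp.toLp 2 a)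

lemma modelPoint_eq_iff {a b : Fin (d + 1) → ℝ} :
    modelPoint a = modelPoint b ↔ ∃ k, ∀ i, a i = b i + k := by
  rw [modelPoint, modelPoint, Submodule.Quotient.eq, Submodule.mem_span_singleton]
  refine exists_congr fun k => ?_
  rw [PiLp.ext_iff]
  refine forall_congr' fun i => ?_
  simp only [PiLp.smul_apply, smul_eq_mul, mul_one, PiLp.sub_apply]
  constructor <;> intro h <;> linarith

lemma modelPoint_sub (a b : Fin (d + 1) → ℝ) : modelPoint (a - b) = modelPoint a - modelPoint b :=
  rfl

lemma sum_smul_integralPoint {ι : Type*} (s : Finset ι) (w : ι → ℝ) (α : ι → Fin (d + 1) → ℤ) :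
    ∑ i ∈ s, w i • integralPoint (α i) = modelPoint fun j => ∑ i ∈ s, w i * α i j := by
  classical
  have h1 : ∀ i, w i • integralPoint (α i) =
      (Submodule.mkQ (Submodule.span ℝ {(WithLp.toLp 2 (fun _ => 1) :
        EuclideanSpace ℝ (Fin (d + 1)))})) (w i • WithLp.toLp 2 fun j => (α i j : ℝ)) := fun _ => rfl
  simp_rw [h1]
  rw [← map_sum]
  refine congrArg (Submodule.Quotient.mk) ?_
  ext j
  simp

/-- The coordinates of `x` in the apartment of a basis orthogonal for the norm of `x`. -/
def apartmentCoord (f : Module.Basis (Fin (d + 1)) K (Fin (d + 1) → K))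
    (x : Realization K d ϖ) : ModelSpace d :=
  modelPoint fun i => Real.log (pointNorm x (f i))

/-- Each vertex norm is split by `f` with log coordinates `α s`. The splitting inequalities are
linear in the logarithms, so they survive averaging. The resulting coordinate does not depend on the
choice of `α`. -/
lemma IsApartmentCoord.splits_and_eq {hϖ : Irreducible ϖ}
    {f : Module.Basis (Fin (d + 1)) K (Fin (d + 1) → K)} {x : Realization K d ϖ} {u : ModelSpace d}
    (h : IsApartmentCoord ϖ hϖ f x u) :
    Splits (dvrAbv O K) f (pointNorm x) ∧ u = apartmentCoord f x := by
  obtain ⟨α, hα, rfl⟩ := h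
  obtain ⟨k, hk⟩ := exists_log_pointNorm_eq x
    (L := fun s => basisLattice (scaledBasis ϖ hϖ f (α s))) hα
  simp only [latticeNorm_basisLattice_scaledBasis hϖ] at hk
  constructor
  · intro v i
    rcases eq_or_ne (f.repr v i) 0 with h0 | h0
    · rw [h0, map_zero, zero_mul]; exact (isUltraNorm_pointNorm hϖ x).nonneg v
    have hv : v ≠ 0 := by rintro rfl; simp at h0
    have ha := (dvrAbv O K).pos h0
    have hf := pointNorm_pos x (f.ne_zero i)
    rw [← Real.log_le_log_iff (mul_pos ha hf) (pointNorm_pos x hv), Real.log_mul ha.ne' hf.ne',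
      hk _ hv, hk _ (f.ne_zero i), ← one_mul (Real.log (dvrAbv O K (f.repr v i))), ← x.sum_weight,
      Finset.sum_mul, add_left_comm, ← Finset.sum_add_distrib]
    refine add_le_add_right (Finset.sum_le_sum fun s _ => ?_) _
    rw [← mul_add]
    refine mul_le_mul_of_nonneg_left ?_ (x.nonneg s)
    rw [splitNorm_basis, ← Real.log_mul ha.ne' (Real.exp_pos _).ne']
    exact Real.log_le_log (mul_pos ha (Real.exp_pos _))
      (le_splitNorm _ f (fun i => (α s i : ℝ)) v i)
  · rw [Finsupp.sum, sum_smul_integralPoint, apartmentCoord, modelPoint_eq_iff]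
    refine ⟨-k, fun i => ?_⟩
    rw [hk _ (f.ne_zero i)]
    simp [splitNorm_basis]

lemma Splits.isApartmentCoord {hϖ : Irreducible ϖ}
    {f : Module.Basis (Fin (d + 1)) K (Fin (d + 1) → K)} {x : Realization K d ϖ}
    (h : Splits (dvrAbv O K) f (pointNorm x)) :
    IsApartmentCoord ϖ hϖ f x (apartmentCoord f x) := by
  have hex : ∀ s : Vertex O K d, ∃ α : Fin (d + 1) → ℤ, s ∈ x.weight.support →
      apartmentVertex ϖ hϖ f α = s := fun s => by
    by_cases hs : s ∈ x.weight.support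
    swap
    · exact ⟨0, fun h => absurd h hs⟩
    obtain ⟨M, r, hr, rfl, hM⟩ := exists_ball_of_mem_support hϖ x hs
    -- The least exponent for which ϖ^α fᵢ lies in the ball of radius `r`; as `f` is orthogonal,
    -- these multiples generate the ball.
    refine ⟨fun i => ⌈Real.log (pointNorm x (f i)) - Real.log r⌉, fun _ => ?_⟩
    refine congrArg Lattice.toVertex (Subtype.ext (Submodule.ext fun v => ?_))
    rw [hM, h.le_iff (isUltraNorm_pointNorm hϖ x) hr.le, mem_iff_latticeNorm_le_one,
      latticeNorm_basisLattice_scaledBasis hϖ, splitNorm_le_iff zero_le_one]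
    refine forall_congr' fun i => ?_
    rcases eq_or_ne (f.repr v i) 0 with h0 | h0
    · simp [h0, hr.le]
    obtain ⟨m, hm⟩ := exists_dvrAbv_eq_exp (O := O) h0
    have hf := pointNorm_pos x (f.ne_zero i)
    rw [hm, ← Real.exp_add, Real.exp_le_one_iff,
      ← Real.log_le_log_iff (mul_pos (Real.exp_pos _) hf) hr,
      Real.log_mul (Real.exp_pos _).ne' hf.ne', Real.log_exp, ← Int.cast_add, Int.cast_nonpos,
      ← le_neg_iff_add_nonpos_left, Int.ceil_le]
    push_cast
    constructor <;> intro h <;> linarith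
  choose α hα using hex
  have hc : IsApartmentCoord ϖ hϖ f x (x.weight.sum fun s w => w • integralPoint (α s)) :=
    ⟨α, hα, rfl⟩
  rwa [hc.splits_and_eq.2] at hc

end Coordinates

/-! ### Euclidean geometry of the quotient by the diagonal -/

section Model

variable {d : ℕ}

/-- The quotient norm is an infimum over translates by constants, so it suffices to compare equal
translates. -/
lemma norm_modelPoint_le {a b : Fin (d + 1) → ℝ}
    (h : ∀ k : ℝ, ∑ i, (a i - k) ^ 2 ≤ ∑ i, (b i - k) ^ 2) :
    ‖modelPoint a‖ ≤ ‖modelPoint b‖ := by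
  refine le_of_forall_pos_le_add fun ε hε => ?_
  obtain ⟨m, hm, hlt⟩ := Submodule.Quotient.norm_mk_lt (modelPoint b) hε
  obtain ⟨k, hk⟩ := modelPoint_eq_iff.1 (show modelPoint (fun i => m i) = modelPoint b from hm)
  have ha : modelPoint a = modelPoint fun i => a i - (-k) :=
    modelPoint_eq_iff.2 ⟨-k, fun i => by ring⟩
  refine le_trans ?_ hlt.le
  rw [ha]
  refine (Submodule.Quotient.norm_mk_le _ _).trans ?_
  rw [EuclideanSpace.norm_eq, EuclideanSpace.norm_eq]
  refine Real.sqrt_le_sqrt ?_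
  simp only [Real.norm_eq_abs, sq_abs]
  refine (h (-k)).trans (Finset.sum_le_sum fun i _ => ?_)
  rw [show m i = b i + k from hk i, sub_neg_eq_add]

lemma exists_norm_eq_norm_mk (u : ModelSpace d) : ∃ m : EuclideanSpace ℝ (Fin (d + 1)),
    (Submodule.Quotient.mk m : ModelSpace d) = u ∧ ‖m‖ = ‖u‖ := by
  obtain ⟨b, rfl⟩ := Submodule.Quotient.mk_surjective _ u
  set S := Submodule.span ℝ {(WithLp.toLp 2 (fun _ => 1) : EuclideanSpace ℝ (Fin (d + 1)))}
  obtain ⟨y, hy, h⟩ := (Submodule.closed_of_finiteDimensional S).exists_infDist_eq_dist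
    ⟨0, S.zero_mem⟩ b
  refine ⟨b - y, ?_, ?_⟩
  · rw [Submodule.Quotient.eq]
    simpa using hy
  · rw [← dist_eq_norm, ← h]
    exact (QuotientAddGroup.norm_mk (S := S.toAddSubgroup) b).symm

/-- The quotient of the Euclidean space is strictly convex. -/
lemma eq_add_smul_of_norm_le {u v c : ModelSpace d} {t : ℝ}
    (h1 : ‖c - u‖ ≤ t * ‖v - u‖) (h2 : ‖v - c‖ ≤ (1 - t) * ‖v - u‖) :
    c = u + t • (v - u) := by
  -- Representatives of minimal norm turn the hypotheses into equality in the Euclidean triangle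
  -- inequality, whence `p = t • (p + q)`.
  obtain ⟨p, hp, hp'⟩ := exists_norm_eq_norm_mk (c - u)
  obtain ⟨q, hq, hq'⟩ := exists_norm_eq_norm_mk (v - c)
  have hpq : (Submodule.Quotient.mk (p + q) : ModelSpace d) = v - u := by
    rw [Submodule.Quotient.mk_add, hp, hq]; abel
  have h3 : ‖v - u‖ ≤ ‖p + q‖ := hpq ▸ Submodule.Quotient.norm_mk_le _ _
  have h4 := norm_add_le p q
  rw [← hp'] at h1
  rw [← hq'] at h2
  have h5 : ‖p + q‖ = ‖v - u‖ := by linarith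
  have e : p = AffineMap.lineMap (0 : EuclideanSpace ℝ (Fin (d + 1))) (p + q) t := by
    refine eq_lineMap_of_dist_eq_mul_of_dist_eq_mul ?_ ?_
    · rw [dist_zero_left, dist_zero_left, h5]; linarith
    · rw [dist_eq_norm, dist_zero_left, sub_add_cancel_left, norm_neg, h5]; linarith
  rw [AffineMap.lineMap_apply_module, smul_zero, zero_add] at e
  rw [← hpq, ← Submodule.Quotient.mk_smul, ← e, hp, add_sub_cancel]

end Model

/-! ### Recognizing a norm of an apartment from its retractions -/

section Retraction

variable {K V : Type*} [Field K] [AddCommGroup V] [Module K V] {abv : AbsoluteValue K ℝ}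
  {N : V → ℝ} {n : ℕ}

lemma IsFlagReduced.const_mul {f : Fin n → V} {i : Fin n} {x : V} (h : IsFlagReduced f K N i x)
    {c : ℝ} (hc : 0 ≤ c) : IsFlagReduced f K (fun v => c * N v) i x :=
  ⟨h.1, fun y hy => mul_le_mul_of_nonneg_left (h.2 y hy) hc⟩

lemma Splits.const_mul {ι : Type*} {g : Module.Basis ι K V} (h : Splits abv g N) {c : ℝ}
    (hc : 0 ≤ c) : Splits abv g fun v => c * N v := fun v i => by
  rw [mul_left_comm]; exact mul_le_mul_of_nonneg_left (h v i) hc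

/-- For every ordering of `f`, the retraction fixes the apartment of `f`. -/
lemma Splits.isFlagReduced {ι : Type*} {f : Module.Basis ι K V} (h : Splits abv f N)
    (σ : Fin n ≃ ι) (i : Fin n) : IsFlagReduced (f ∘ σ) K N i (f (σ i)) := by
  refine ⟨by simp, fun y hy => ?_⟩
  have hle : Submodule.span K ((f ∘ σ) '' Set.Iio i) ≤ LinearMap.ker (f.coord (σ i)) := by
    rw [Submodule.span_le]
    rintro _ ⟨l, hl, rfl⟩
    have : σ l ≠ σ i := fun h => (ne_of_lt hl) (σ.injective h)
    simp [this]
  have h1 : f.coord (σ i) (y - f (σ i)) = 0 := hle hy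
  have h2 : f.repr y (σ i) = 1 := by
    rw [map_sub, sub_eq_zero] at h1
    simpa using h1
  simpa [h2] using h y (σ i)

/-- A norm whose retractions onto the apartment of `f`, for all orderings of `f`, agree up to
constants is split by `f`. -/
lemma splits_of_forall_flagReduced {d : ℕ} (hN : IsUltraNorm abv N)
    (f : Module.Basis (Fin (d + 1)) K V) (c : Fin (d + 1) → ℝ)
    (h : ∀ σ : Equiv.Perm (Fin (d + 1)), ∃ (g : Fin (d + 1) → V) (k : ℝ), ∀ i,
      IsFlagReduced (f ∘ σ) K N i (g i) ∧ Real.log (N (g i)) = c (σ i) + k) :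
    Splits abv f N ∧ ∃ k : ℝ, ∀ i, Real.log (N (f i)) = c i + k := by
  -- Use an ordering with `i` first and `j` last. The first reduced vector is `f i` itself, which
  -- determines the constant `k`. The last one, `y`, is minimal in the coset of `f j` modulo all
  -- other basis vectors, which bounds the `j`-th coordinate of every `w`.
  have key : ∀ i j, i ≠ j → ∃ y, Real.log (N y) = c j + (Real.log (N (f i)) - c i) ∧ 0 < N y ∧
      ∀ w, abv (f.repr w j) * N y ≤ N w := by
    intro i j hij
    let τ : Equiv.Perm (Fin (d + 1)) := Equiv.swap 0 i
    let σ : Equiv.Perm (Fin (d + 1)) := (Equiv.swap (Fin.last d) (τ j)).trans τ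
    have hσl : σ (Fin.last d) = j := by simp [σ, τ]
    have hσ0 : σ 0 = i := by
      have h1 : (0 : Fin (d + 1)) ≠ Fin.last d := by
        intro h0
        have : d = 0 := by simpa [Fin.ext_iff] using h0.symm
        exact hij (Fin.ext (by omega))
      have h2 : (0 : Fin (d + 1)) ≠ τ j := by
        intro h0
        have := congrArg τ h0
        simp only [τ, Equiv.swap_apply_left, Equiv.swap_apply_self] at this
        exact hij this
      simp [σ, Equiv.swap_apply_of_ne_of_ne h1 h2, τ]
    obtain ⟨g, k, hg⟩ := h σ
    have hli : LinearIndependent K (f ∘ σ) := f.linearIndependent.comp _ σ.injective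
    have h0 : g 0 = f i := by
      have := (hg 0).1.1
      have he : Set.Iio (0 : Fin (d + 1)) = ∅ := by ext l; simp
      rw [he, Set.image_empty, Submodule.span_empty, Submodule.mem_bot, sub_eq_zero] at this
      rw [this, Function.comp_apply, hσ0]
    have hk := (hg 0).2
    rw [h0, hσ0] at hk
    refine ⟨g (Fin.last d), ?_, hN.pos _ (ne_zero_of_sub_mem_span hli (hg _).1.1), fun w => ?_⟩
    · rw [(hg _).2, hσl, hk]; ring
    · rcases eq_or_ne (f.repr w j) 0 with hw | hw
      · rw [hw, map_zero, zero_mul]; exact hN.nonneg w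
      have hmem : (f.repr w j)⁻¹ • w - (f ∘ σ) (Fin.last d) ∈
          Submodule.span K ((f ∘ σ) '' Set.Iio (Fin.last d)) := by
        rw [Function.comp_apply, hσl]
        have hsum : (f.repr w j)⁻¹ • w - f j =
            ∑ l ∈ Finset.univ.erase j, ((f.repr w j)⁻¹ * f.repr w l) • f l := by
          rw [sub_eq_iff_eq_add]
          conv_lhs => rw [← f.sum_repr w, Finset.smul_sum]
          rw [← Finset.sum_erase_add _ _ (Finset.mem_univ j)]
          simp only [smul_smul, f.sum_repr, inv_mul_cancel₀ hw, one_smul]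
        rw [hsum]
        refine sum_mem fun l hl => Submodule.smul_mem _ _ (Submodule.subset_span ?_)
        refine ⟨σ.symm l, ?_, by simp⟩
        refine lt_of_le_of_ne (Fin.le_last _) fun he => (Finset.ne_of_mem_erase hl) ?_
        rw [← hσl, ← he, Equiv.apply_symm_apply]
      have := (hg (Fin.last d)).1.2 _ hmem
      rw [hN.smul, map_inv₀, le_inv_mul_iff₀ (abv.pos hw)] at this
      exact this
  -- Apply `key` to `w = f j`. By symmetry equality holds, so `f j` has the same norm as the minimal
  -- vector `y`.
  have hle : ∀ i j, i ≠ j → Real.log (N (f i)) - c i ≤ Real.log (N (f j)) - c j := by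
    intro i j hij
    obtain ⟨y, h1, h2, h3⟩ := key i j hij
    have := h3 (f j)
    simp only [Module.Basis.repr_self, Finsupp.single_eq_same, map_one, one_mul] at this
    have := Real.log_le_log h2 this
    linarith
  have heq : ∀ i j, Real.log (N (f i)) - c i = Real.log (N (f j)) - c j := by
    intro i j
    rcases eq_or_ne i j with rfl | hij
    · rfl
    · exact le_antisymm (hle i j hij) (hle j i hij.symm)
  refine ⟨fun w j => ?_, Real.log (N (f 0)) - c 0, fun i => by linarith [heq i 0]⟩
  by_cases hex : ∃ i, i ≠ j
  · obtain ⟨i, hij⟩ := hex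
    obtain ⟨y, h1, h2, h3⟩ := key i j hij
    have : N (f j) = N y := by
      rw [← Real.exp_log (hN.pos _ (f.ne_zero j)), ← Real.exp_log h2, h1]
      congr 1
      linarith [heq i j]
    rw [this]
    exact h3 w
  -- In dimension one there is no second index, and any basis is orthogonal.
  · push Not at hex
    rw [← hN.smul]
    refine le_of_eq (congrArg N ?_)
    conv_rhs => rw [← f.sum_repr w]
    rw [Fintype.sum_eq_single j fun i hi => absurd (hex i) hi]

end Retraction

/-! ### Finiteness of the values of a ratio of norms -/

section FiniteRatio

variable {V : Type*} [Zero V] {N N' M : V → ℝ}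

/-- The ratio of two norms takes finitely many values. -/
def FiniteRatio (N N' : V → ℝ) : Prop :=
  (Set.range fun v : {v : V // v ≠ 0} => Real.log (N v) - Real.log (N' v)).Finite

lemma FiniteRatio.trans_symm (h : FiniteRatio N M) (h' : FiniteRatio N' M) : FiniteRatio N N' := by
  refine (Set.Finite.image2 (fun a b => a - b) h h').subset ?_
  rintro _ ⟨v, rfl⟩
  exact ⟨_, ⟨v, rfl⟩, _, ⟨v, rfl⟩, by ring⟩

lemma finite_range_sum {X ι : Type*} (s : Finset ι) (w : ι → ℝ) (f : ι → X → ℝ)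
    (h : ∀ i, (Set.range (f i)).Finite) : (Set.range fun x => ∑ i ∈ s, w i * f i x).Finite := by
  classical
  induction s using Finset.induction_on with
  | empty => exact (Set.finite_singleton 0).subset (by rintro _ ⟨x, rfl⟩; simp)
  | insert a s ha ih =>
    refine (Set.Finite.image2 (fun b c => w a * b + c) (h a) ih).subset ?_
    rintro _ ⟨x, rfl⟩
    exact ⟨_, ⟨x, rfl⟩, _, ⟨x, rfl⟩,
      (Finset.sum_insert (f := fun i => w i * f i x) ha).symm⟩

end FiniteRatio

/-- Finiteness of the set of ratios replaces compactness of the unit sphere, which fails when the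
residue field is infinite. -/
lemma FiniteRatio.exists_max {K V : Type*} [Field K] [AddCommGroup V] [Module K V]
    {abv : AbsoluteValue K ℝ} {N N' : V → ℝ} (h : FiniteRatio N N') (hN : IsUltraNorm abv N)
    (hN' : IsUltraNorm abv N') (W : Submodule K V) (hW : W ≠ ⊥) :
    ∃ v ∈ W, v ≠ 0 ∧ ∀ w ∈ W, N w * N' v ≤ N v * N' w := by
  obtain ⟨v₀, hv₀, hne⟩ := W.exists_mem_ne_zero_of_ne_bot hW
  let S : Set ℝ := {r | ∃ v ∈ W, v ≠ 0 ∧ r = Real.log (N v) - Real.log (N' v)}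
  have hS : S.Finite := h.subset (by rintro _ ⟨v, -, hv, rfl⟩; exact ⟨⟨v, hv⟩, rfl⟩)
  obtain ⟨_, ⟨v, hvW, hv, rfl⟩, hmax⟩ := Set.exists_max_image S id hS ⟨_, v₀, hv₀, hne, rfl⟩
  refine ⟨v, hvW, hv, fun w hwW => ?_⟩
  rcases eq_or_ne w 0 with rfl | hw
  · simp [hN.map_zero, hN'.map_zero]
  have := hmax _ ⟨w, hwW, hw, rfl⟩
  simp only [id] at this
  have h1 := hN.pos v hv; have h2 := hN'.pos v hv; have h3 := hN.pos w hw; have h4 := hN'.pos w hw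
  rw [← Real.log_le_log_iff (mul_pos h3 h2) (mul_pos h1 h4), Real.log_mul h3.ne' h2.ne',
    Real.log_mul h1.ne' h4.ne']
  linarith

lemma IsUltraNorm.exists_log_le {K V ι : Type*} [Field K] [AddCommGroup V] [Module K V] [Fintype ι]
    {abv : AbsoluteValue K ℝ} {N N' : V → ℝ} (hN : IsUltraNorm abv N) (hN' : IsUltraNorm abv N')
    {g : Module.Basis ι K V} (hg : Splits abv g N') :
    ∃ C : ℝ, ∀ v, v ≠ 0 → Real.log (N v) ≤ C + Real.log (N' v) := by
  refine ⟨∑ i, |Real.log (N (g i)) - Real.log (N' (g i))|, fun v hv => ?_⟩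
  obtain ⟨i, hi⟩ := hN.exists_repr g hv
  have hne : g.repr v i ≠ 0 := fun h => by
    rw [h, abv.map_zero, zero_mul] at hi; exact (hN.pos v hv).not_ge hi
  have h1 := Real.log_le_log (hN.pos v hv) hi
  have hpos := abv.pos hne
  have h2 := Real.log_le_log (mul_pos hpos (hN'.pos _ (g.ne_zero i))) (hg v i)
  rw [Real.log_mul hpos.ne' (hN.pos _ (g.ne_zero i)).ne'] at h1
  rw [Real.log_mul hpos.ne' (hN'.pos _ (g.ne_zero i)).ne'] at h2
  have h3 := Finset.single_le_sum (f := fun i => |Real.log (N (g i)) - Real.log (N' (g i))|)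
    (fun _ _ => abs_nonneg _) (Finset.mem_univ i)
  have h4 := le_abs_self (Real.log (N (g i)) - Real.log (N' (g i)))
  linarith

/-! ### Common apartments, the distance and geodesics -/

section Building

variable {O K : Type*} [CommRing O] [IsDomain O] [IsDiscreteValuationRing O] [Field K] [Algebra O K]
  [IsFractionRing O K] {d : ℕ} {ϖ : O}

lemma Lattice.exists_splits (L : Lattice O K d) :
    ∃ b : Module.Basis (Fin (d + 1)) K (Fin (d + 1) → K), Splits (dvrAbv O K) b (latticeNorm L) :=
  ⟨_, splits_splitNorm _ _ _⟩

/-- Log ratios of two lattice norms are integers, and they are bounded because the norms are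
equivalent. -/
lemma finiteRatio_latticeNorm (L M : Lattice O K d) :
    FiniteRatio (latticeNorm L) (latticeNorm M) := by
  obtain ⟨b, hb⟩ := L.exists_splits
  obtain ⟨c, hc⟩ := M.exists_splits
  obtain ⟨B, hB⟩ := (isUltraNorm_latticeNorm M).exists_log_le (isUltraNorm_latticeNorm L) hb
  obtain ⟨C, hC⟩ := (isUltraNorm_latticeNorm L).exists_log_le (isUltraNorm_latticeNorm M) hc
  refine ((Set.finite_Icc (-⌈B⌉) ⌈C⌉).image (fun m : ℤ => (m : ℝ))).subset ?_
  rintro _ ⟨⟨v, hv⟩, rfl⟩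
  have h1 := hB v hv
  have h2 := hC v hv
  rw [log_latticeNorm L hv, log_latticeNorm M hv] at h1 h2
  have h3 := Int.le_ceil B
  have h4 := Int.le_ceil C
  refine ⟨latticeLog L v - latticeLog M v, ⟨?_, ?_⟩, ?_⟩
  · rw [← Int.cast_le (R := ℝ)]; push_cast; linarith
  · rw [← Int.cast_le (R := ℝ)]; push_cast; linarith
  · simp [log_latticeNorm L hv, log_latticeNorm M hv]

lemma finiteRatio_pointNorm (x : Realization K d ϖ) (L : Lattice O K d) :
    FiniteRatio (pointNorm x) (latticeNorm L) := by
  have := finite_range_sum x.weight.support x.weight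
    (fun s (v : {v : Fin (d + 1) → K // v ≠ 0}) =>
      Real.log (latticeNorm s.rep v) - Real.log (latticeNorm L v))
    fun s => finiteRatio_latticeNorm s.rep L
  refine this.subset ?_
  rintro _ ⟨v, rfl⟩
  refine ⟨v, ?_⟩
  simp only [mul_sub, Finset.sum_sub_distrib]
  rw [← Finset.sum_mul, x.sum_weight, one_mul, log_pointNorm x v.2]

/-- Any two points of the building lie in a common apartment. -/
theorem exists_common_apartment (hϖ : Irreducible ϖ) (x y : Realization K d ϖ) :
    ∃ f : Module.Basis (Fin (d + 1)) K (Fin (d + 1) → K),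
      Splits (dvrAbv O K) f (pointNorm x) ∧ Splits (dvrAbv O K) f (pointNorm y) := by
  let L₀ : Lattice O K d := basisLattice (Pi.basisFun K (Fin (d + 1)))
  have hL := isUltraNorm_latticeNorm L₀
  have hx := isUltraNorm_pointNorm hϖ x
  have hy := isUltraNorm_pointNorm hϖ y
  have hn : Module.finrank K (Fin (d + 1) → K) = d + 1 := by simp
  obtain ⟨b, hb⟩ := L₀.exists_splits
  -- A first comparison with the standard lattice, known to be split, yields a basis splitting `x`,
  -- hence the norming functionals needed to compare `x` with `y`.
  obtain ⟨g, -, hg⟩ := exists_common_splitting hL hx (fun v hv => hb.exists_norming hL hv)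
    (((finiteRatio_latticeNorm L₀ L₀).trans_symm (finiteRatio_pointNorm x L₀)).exists_max hL hx) hn
  exact exists_common_splitting hx hy (fun v hv => hg.exists_norming hx hv)
    (((finiteRatio_pointNorm x L₀).trans_symm (finiteRatio_pointNorm y L₀)).exists_max hx hy) hn

/-- The Lipschitz theorem is applied to all rescalings exp(k) · N_y, which gives the comparison of
every translate and so of the quotient norms. The indexing by `σ.symm` expresses coordinates
relative to `f` rather than to its reordering. -/
lemma dist_modelPoint_le (hϖ : Irreducible ϖ) {x y : Realization K d ϖ}
    {f g : Module.Basis (Fin (d + 1)) K (Fin (d + 1) → K)} (hx : Splits (dvrAbv O K) g (pointNorm x))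
    (hy : Splits (dvrAbv O K) g (pointNorm y)) (σ : Equiv.Perm (Fin (d + 1)))
    {h h' : Fin (d + 1) → Fin (d + 1) → K}
    (hh : ∀ i, IsFlagReduced (f ∘ σ) K (pointNorm x) i (h i))
    (hh' : ∀ i, IsFlagReduced (f ∘ σ) K (pointNorm y) i (h' i)) :
    ‖modelPoint (fun i => Real.log (pointNorm x (h (σ.symm i)))) -
      modelPoint (fun i => Real.log (pointNorm y (h' (σ.symm i))))‖ ≤
      ‖apartmentCoord g x - apartmentCoord g y‖ := by
  have hli : LinearIndependent K (f ∘ σ) := f.linearIndependent.comp _ σ.injective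
  have hNx := isUltraNorm_pointNorm hϖ x
  have hNy := isUltraNorm_pointNorm hϖ y
  rw [apartmentCoord, apartmentCoord, ← modelPoint_sub, ← modelPoint_sub]
  refine norm_modelPoint_le fun k => ?_
  have hek := Real.exp_pos k
  have key := sum_sq_log_flagReduced_le (isNonarchimedean_dvrAbv O K) hli hNx
    (hNy.const_mul hek) hx (hy.const_mul hek.le) hh fun i => (hh' i).const_mul hek.le
  have hlog : ∀ v, v ≠ 0 → Real.log (Real.exp k * pointNorm y v) =
      k + Real.log (pointNorm y v) := fun v hv => by
    rw [Real.log_mul hek.ne' (hNy.pos v hv).ne', Real.log_exp]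
  simp only [fun i => hlog (h' i) (ne_zero_of_sub_mem_span hli (hh' i).1),
    fun i => hlog (g i) (g.ne_zero i)] at key
  rw [← Equiv.sum_comp σ]
  simp only [Pi.sub_apply, Equiv.symm_apply_apply]
  convert key using 3 <;> ring

lemma norm_apartmentCoord_sub_le (hϖ : Irreducible ϖ) {x y : Realization K d ϖ}
    {f g : Module.Basis (Fin (d + 1)) K (Fin (d + 1) → K)} (hx : Splits (dvrAbv O K) f (pointNorm x))
    (hy : Splits (dvrAbv O K) f (pointNorm y)) (hx' : Splits (dvrAbv O K) g (pointNorm x))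
    (hy' : Splits (dvrAbv O K) g (pointNorm y)) :
    ‖apartmentCoord f x - apartmentCoord f y‖ ≤ ‖apartmentCoord g x - apartmentCoord g y‖ :=
  dist_modelPoint_le hϖ hx' hy' (Equiv.refl _) (f := f) (fun i => hx.isFlagReduced (Equiv.refl _) i)
    fun i => hy.isFlagReduced (Equiv.refl _) i

lemma euclDist_eq (hϖ : Irreducible ϖ) {x y : Realization K d ϖ}
    {f : Module.Basis (Fin (d + 1)) K (Fin (d + 1) → K)} (hx : Splits (dvrAbv O K) f (pointNorm x))
    (hy : Splits (dvrAbv O K) f (pointNorm y)) :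
    euclDist ϖ hϖ x y = ‖apartmentCoord f x - apartmentCoord f y‖ := by
  have : {r | ∃ (f : Module.Basis (Fin (d + 1)) K (Fin (d + 1) → K)) (u v : ModelSpace d),
      IsApartmentCoord ϖ hϖ f x u ∧ IsApartmentCoord ϖ hϖ f y v ∧ r = dist u v} =
      {‖apartmentCoord f x - apartmentCoord f y‖} := by
    ext r
    rw [Set.mem_singleton_iff]
    constructor
    · rintro ⟨g, u, v, hu, hv, rfl⟩
      obtain ⟨hu', rfl⟩ := hu.splits_and_eq
      obtain ⟨hv', rfl⟩ := hv.splits_and_eq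
      rw [dist_eq_norm]
      exact le_antisymm (norm_apartmentCoord_sub_le hϖ hu' hv' hx hy)
        (norm_apartmentCoord_sub_le hϖ hx hy hu' hv')
    · rintro rfl
      exact ⟨f, _, _, hx.isApartmentCoord, hy.isApartmentCoord, (dist_eq_norm _ _).symm⟩
  rw [euclDist, this, csInf_singleton]

/-- A point dividing the distance between `x` and `y` in the ratio `t : 1 - t` lies on the segment
from `x` to `y` in any apartment containing `x` and `y`. -/
theorem splits_of_euclDist_eq (hϖ : Irreducible ϖ) {x y z : Realization K d ϖ} {t : ℝ}
    (hxz : euclDist ϖ hϖ x z = t * euclDist ϖ hϖ x y)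
    (hzy : euclDist ϖ hϖ z y = (1 - t) * euclDist ϖ hϖ x y)
    {f : Module.Basis (Fin (d + 1)) K (Fin (d + 1) → K)} (hx : Splits (dvrAbv O K) f (pointNorm x))
    (hy : Splits (dvrAbv O K) f (pointNorm y)) :
    Splits (dvrAbv O K) f (pointNorm z) ∧ ∃ k : ℝ, ∀ i, Real.log (pointNorm z (f i)) =
      (1 - t) * Real.log (pointNorm x (f i)) + t * Real.log (pointNorm y (f i)) + k := by
  have hNz := isUltraNorm_pointNorm hϖ z
  obtain ⟨g, hgx, hgz⟩ := exists_common_apartment hϖ x z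
  obtain ⟨g', hgz', hgy⟩ := exists_common_apartment hϖ z y
  refine splits_of_forall_flagReduced hNz f _ fun σ => ?_
  have hli : LinearIndependent K (f ∘ σ) := f.linearIndependent.comp _ σ.injective
  obtain ⟨h, hh⟩ := exists_isFlagReduced hli hNz hgz
  have hfx : ∀ i, IsFlagReduced (f ∘ σ) K (pointNorm x) i (f (σ i)) := hx.isFlagReduced σ
  have hfy : ∀ i, IsFlagReduced (f ∘ σ) K (pointNorm y) i (f (σ i)) := hy.isFlagReduced σ
  have h1 := dist_modelPoint_le hϖ hgx hgz σ hfx hh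
  have h2 := dist_modelPoint_le hϖ hgz' hgy σ hh hfy
  simp only [Equiv.apply_symm_apply] at h1 h2
  rw [← euclDist_eq hϖ hgx hgz, hxz, euclDist_eq hϖ hx hy, norm_sub_rev,
    norm_sub_rev (apartmentCoord f x)] at h1
  rw [← euclDist_eq hϖ hgz' hgy, hzy, euclDist_eq hϖ hx hy, norm_sub_rev,
    norm_sub_rev (apartmentCoord f x)] at h2
  -- The retraction fixes `x` and `y` and shortens the distances from `z` to both, so strict
  -- convexity determines the image of `z`, independently of `σ`.
  have key := eq_add_smul_of_norm_le h1 h2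
  have e : apartmentCoord f x + t • (apartmentCoord f y - apartmentCoord f x) =
      modelPoint fun i => (1 - t) * Real.log (pointNorm x (f i)) +
        t * Real.log (pointNorm y (f i)) := by
    refine Eq.trans (b := modelPoint fun i => Real.log (pointNorm x (f i)) +
      t * (Real.log (pointNorm y (f i)) - Real.log (pointNorm x (f i)))) rfl
      (congrArg modelPoint ?_)
    ext i
    ring
  obtain ⟨k, hk⟩ := modelPoint_eq_iff.1 (key.trans e)
  exact ⟨h, k, fun i => ⟨hh i, by simpa using hk (σ i)⟩⟩

end Building

/-! ### Oscillation of the ratio of two norms and its convexity -/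

section LogOscillation

variable {V : Type*} [Zero V] {N M P : V → ℝ} {a b : ℝ}

/-- The logarithm of `N / M` has oscillation at most `a`. -/
def LogOsc (N M : V → ℝ) (a : ℝ) : Prop :=
  ∀ v w, v ≠ 0 → w ≠ 0 →
    Real.log (N v) - Real.log (M v) ≤ Real.log (N w) - Real.log (M w) + a

lemma LogOsc.symm (h : LogOsc N M a) : LogOsc M N a := fun v w hv hw => by
  have := h w v hw hv
  linarith

lemma LogOsc.trans (h : LogOsc N M a) (h' : LogOsc M P b) : LogOsc N P (a + b) :=
  fun v w hv hw => by
    have := h v w hv hw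
    have := h' v w hv hw
    linarith

lemma LogOsc.mono (h : LogOsc N M a) (hab : a ≤ b) : LogOsc N M b := fun v w hv hw => by
  have := h v w hv hw
  linarith

lemma logOsc_self (N : V → ℝ) : LogOsc N N 0 := fun v w _ _ => by simp

end LogOscillation

/-- The condition `LogOsc · M a` is convex along the segments of an apartment. -/
lemma LogOsc.convex {K V ι : Type*} [Field K] [AddCommGroup V] [Module K V] [Fintype ι]
    {abv : AbsoluteValue K ℝ} {X Y Z M : V → ℝ} {f : Module.Basis ι K V} {a t k : ℝ}
    (hX : IsUltraNorm abv X) (hY : IsUltraNorm abv Y) (hZ : IsUltraNorm abv Z)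
    (hM : IsUltraNorm abv M) (hfX : Splits abv f X) (hfY : Splits abv f Y) (hfZ : Splits abv f Z)
    (ht : t ∈ Set.Icc (0 : ℝ) 1)
    (h : ∀ i, Real.log (Z (f i)) = (1 - t) * Real.log (X (f i)) + t * Real.log (Y (f i)) + k)
    (hXM : LogOsc X M a) (hYM : LogOsc Y M a) : LogOsc Z M a := by
  have hlow : ∀ N : V → ℝ, IsUltraNorm abv N → Splits abv f N → ∀ v i, f.repr v i ≠ 0 → v ≠ 0 →
      Real.log (abv (f.repr v i)) + Real.log (N (f i)) ≤ Real.log (N v) := by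
    intro N hN hfN v i hi hv
    have h1 := abv.pos hi
    have h2 := hN.pos _ (f.ne_zero i)
    rw [← Real.log_mul h1.ne' h2.ne']
    exact Real.log_le_log (mul_pos h1 h2) (hfN v i)
  have hup : ∀ N : V → ℝ, IsUltraNorm abv N → ∀ v, v ≠ 0 → ∃ i, f.repr v i ≠ 0 ∧
      Real.log (N v) ≤ Real.log (abv (f.repr v i)) + Real.log (N (f i)) := by
    intro N hN v hv
    obtain ⟨i, hi⟩ := hN.exists_repr f hv
    have hne : f.repr v i ≠ 0 := fun h => by
      rw [h, abv.map_zero, zero_mul] at hi; exact (hN.pos v hv).not_ge hi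
    refine ⟨i, hne, ?_⟩
    rw [← Real.log_mul (abv.pos hne).ne' (hN.pos _ (f.ne_zero i)).ne']
    exact Real.log_le_log (hN.pos v hv) hi
  intro v w hv hw
  -- `i` carries the `Z`-norm of `v`, and `j` bounds the `M`-norm of `w`. Comparing `v` with `f j`
  -- in the hypotheses on `X` and `Y` avoids asking that `f` split `M`.
  obtain ⟨i, hi, h1⟩ := hup Z hZ v hv
  obtain ⟨j, hj, h2⟩ := hup M hM w hw
  have h3 := hlow Z hZ hfZ w j hj hw
  have h4 := hlow X hX hfX v i hi hv
  have h5 := hlow Y hY hfY v i hi hv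
  have h6 := hXM v (f j) hv (f.ne_zero j)
  have h7 := hYM v (f j) hv (f.ne_zero j)
  rw [h] at h1 h3
  have h8 := mul_le_mul_of_nonneg_left (h4.trans (sub_le_iff_le_add.1 h6)) (sub_nonneg.2 ht.2)
  have h9 := mul_le_mul_of_nonneg_left (h5.trans (sub_le_iff_le_add.1 h7)) ht.1
  linarith

/-! ### Lattice chains, simplices and the combinatorial distance -/

section

variable {O K : Type*} [CommRing O] [Field K] [Algebra O K] {d : ℕ} {ϖ : O}

lemma algebraMap_smul_submodule (S : Submodule O (Fin (d + 1) → K)) (a : O) :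
    algebraMap O K a • S = a • S := by
  ext v
  simp [Submodule.mem_smul_pointwise_iff_exists]

/-- The lattice `c L`. -/
def Lattice.smul (c : K) (hc : c ≠ 0) (L : Lattice O K d) : Lattice O K d :=
  ⟨c • L.1, by
    have := L.2
    exact Submodule.IsLattice.smul K L.1 (Units.mk0 c hc)⟩

lemma Lattice.toVertex_smul (c : K) (hc : c ≠ 0) (L : Lattice O K d) :
    (L.smul c hc).toVertex = L.toVertex :=
  Quotient.sound ⟨c⁻¹, inv_ne_zero hc, (inv_smul_smul₀ hc L.1).symm⟩

lemma uniformizer_smul_le_iff {S T : Submodule O (Fin (d + 1) → K)} :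
    ϖ • S ≤ T ↔ ∀ v ∈ S, v ≠ 0 → algebraMap O K ϖ • v ∈ T := by
  simp only [algebraMap_smul]
  constructor
  · exact fun h v hv _ => h (Submodule.smul_mem_pointwise_smul v ϖ S hv)
  · intro h w hw
    obtain ⟨v, hv, rfl⟩ := (Submodule.mem_smul_pointwise_iff_exists _ _ _).1 hw
    rcases eq_or_ne v 0 with rfl | hv0
    · simp
    · exact h v hv hv0

lemma le_iff_forall_ne_zero {S T : Submodule O (Fin (d + 1) → K)} :
    S ≤ T ↔ ∀ v ∈ S, v ≠ 0 → v ∈ T := by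
  refine ⟨fun h v hv _ => h hv, fun h v hv => ?_⟩
  rcases eq_or_ne v 0 with rfl | hv0
  · exact T.zero_mem
  · exact h v hv hv0

end

section Lattices

variable {O K : Type*} [CommRing O] [IsDomain O] [IsDiscreteValuationRing O] [Field K] [Algebra O K]
  [IsFractionRing O K] {d : ℕ} {ϖ : O}

/-- A submodule between two lattices is a lattice. -/
def Lattice.ofLeLe (S : Submodule O (Fin (d + 1) → K)) (L M : Lattice O K d) (hL : L.1 ≤ S)
    (hM : S ≤ M.1) : Lattice O K d :=
  ⟨S, by
    have := L.2
    have := M.2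
    refine Submodule.IsLattice.of_le_of_isLattice_of_fg K hL ?_
    have : IsNoetherian O S := isNoetherian_of_le hM
    exact Module.Finite.iff_fg.1 inferInstance⟩

lemma latticeLog_uniformizer_smul (hϖ : Irreducible ϖ) (L : Lattice O K d) {v : Fin (d + 1) → K}
    (hv : v ≠ 0) : latticeLog L (algebraMap O K ϖ • v) = latticeLog L v - 1 := by
  have hϖ' := algebraMap_uniformizer_ne_zero (K := K) hϖ
  have h := (isUltraNorm_latticeNorm L).smul (algebraMap O K ϖ) v
  rw [latticeNorm_eq_exp L hv, latticeNorm_eq_exp L (smul_ne_zero hϖ' hv), dvrAbv_uniformizer hϖ,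
    ← Real.exp_add, Real.exp_eq_exp] at h
  have : ((latticeLog L (algebraMap O K ϖ • v) : ℤ) : ℝ) = ((latticeLog L v - 1 : ℤ) : ℝ) := by
    rw [h]; push_cast; ring
  exact_mod_cast this

lemma uniformizer_smul_ne (hϖ : Irreducible ϖ) (L : Lattice O K d) : ϖ • L.1 ≠ L.1 := by
  intro h
  obtain ⟨v, hv⟩ := exists_ne (0 : Fin (d + 1) → K)
  have h1 := latticeNorm_eq_of_ball (L := L) (N := fun v => Real.exp 1 * latticeNorm L v)
    (fun v hv => ⟨1 + latticeLog L v, by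
      simp only [latticeNorm_eq_exp L hv]; rw [← Real.exp_add]; simp⟩)
    ((isUltraNorm_latticeNorm L).const_mul (Real.exp_pos _)) (fun v => by
      rw [← h, ← algebraMap_smul_submodule, mem_smul_iff (algebraMap_uniformizer_ne_zero hϖ),
        mem_iff_latticeNorm_le_one, (isUltraNorm_latticeNorm L).smul, map_inv₀,
        dvrAbv_uniformizer hϖ, Real.exp_neg, inv_inv])
  have h2 := congrFun h1 v
  have h3 := (isUltraNorm_latticeNorm L).pos v hv
  have h4 : (1 : ℝ) < Real.exp 1 := by simp
  nlinarith

/-- A finite chain of lattices `L` with `ϖ L ⊆ M` for all `L`, `M` defines a simplex. -/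
lemma isSimplex_image (hϖ : Irreducible ϖ) {S : Set (Lattice O K d)} (hfin : S.Finite)
    (hne : S.Nonempty) (htot : ∀ L ∈ S, ∀ M ∈ S, L.1 ≤ M.1 ∨ M.1 ≤ L.1)
    (hϖS : ∀ L ∈ S, ∀ M ∈ S, ϖ • L.1 ≤ M.1) : IsSimplex ϖ (Lattice.toVertex '' S) := by
  classical
  obtain ⟨T, hT, hTmax⟩ : ∃ T ∈ S, ∀ L ∈ S, L.1 ≤ T.1 := by
    obtain ⟨T, hT⟩ := hfin.exists_maximal hne
    exact ⟨T, hT.1, fun L hL => (htot L hL T hT.1).elim id fun h => hT.2 hL h⟩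
  -- A simplex requires ϖ M_k ≠ M₀. The only possible obstruction, ϖ T, represents the same vertex
  -- as `T` and can be dropped.
  set S' : Set (Lattice O K d) := {L ∈ S | L.1 ≠ ϖ • T.1} with hS'
  have hTS' : T ∈ S' := ⟨hT, (uniformizer_smul_ne hϖ T).symm⟩
  have himage : Lattice.toVertex '' S = Lattice.toVertex '' S' := by
    refine subset_antisymm ?_ (Set.image_mono fun L hL => hL.1)
    rintro _ ⟨L, hL, rfl⟩
    by_cases h : L.1 = ϖ • T.1
    · refine ⟨T, hTS', Quotient.sound ⟨algebraMap O K ϖ, algebraMap_uniformizer_ne_zero hϖ, ?_⟩⟩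
      rw [h, algebraMap_smul_submodule]
    · exact ⟨L, ⟨hL, h⟩, rfl⟩
  have : Fintype S' := (hfin.subset fun L hL => hL.1).fintype
  let _ : LinearOrder S' :=
    { (inferInstance : PartialOrder S') with
      le_total := fun L M => htot L.1 L.2.1 M.1 M.2.1
      toDecidableLE := Classical.decRel _ }
  obtain ⟨k, hk⟩ : ∃ k, Fintype.card S' = k + 1 :=
    have : Nonempty S' := ⟨⟨T, hTS'⟩⟩
    Nat.exists_eq_succ_of_ne_zero Fintype.card_ne_zero
  let e := Fintype.orderIsoFinOfCardEq S' hk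
  have hlast : (e (Fin.last k)).1 = T := by
    refine Subtype.ext (le_antisymm (hTmax _ (e _).2.1) ?_)
    have : (⟨T, hTS'⟩ : S') ≤ e (Fin.last k) := by
      rw [← e.symm_apply_le]; exact Fin.le_last _
    exact this
  refine ⟨k, fun i => (e i).1, fun i j hij => e.strictMono hij, ?_, ?_⟩
  · beta_reduce
    rw [hlast]
    exact lt_of_le_of_ne (hϖS T hT _ (e 0).2.1) (e 0).2.2.symm
  · rw [himage]
    ext s
    constructor
    · rintro ⟨L, hL, rfl⟩
      exact ⟨e.symm ⟨L, hL⟩, by simp⟩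
    · rintro ⟨i, rfl⟩
      exact ⟨_, (e i).2, rfl⟩

/-- The path runs through the lattices M + ϖ^j L: consecutive ones are nested, and ϖ times the
larger lies in the smaller, so their vertices are equal or adjacent. -/
lemma combDist_toVertex_le (hϖ : Irreducible ϖ) (n : ℕ) {L M : Lattice O K d} (hML : M.1 ≤ L.1)
    (hLM : ϖ ^ n • L.1 ≤ M.1) : combDist ϖ L.toVertex M.toVertex ≤ n := by
  induction n generalizing M with
  | zero =>
    rw [pow_zero, one_smul] at hLM
    obtain rfl : L = M := Subtype.ext (le_antisymm hLM hML)
    simp [combDist]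
  | succ n ih =>
    have hϖL : ∀ (m : ℕ) (S : Submodule O (Fin (d + 1) → K)), ϖ ^ m • S ≤ S := fun m S => by
      intro v hv
      obtain ⟨w, hw, rfl⟩ := (Submodule.mem_smul_pointwise_iff_exists _ _ _).1 hv
      exact S.smul_mem _ hw
    let M' : Lattice O K d := Lattice.ofLeLe (M.1 ⊔ ϖ ^ n • L.1) M L le_sup_left
      (sup_le hML (hϖL n _))
    have hM' : M'.1 = M.1 ⊔ ϖ ^ n • L.1 := rfl
    have h1 : combDist ϖ L.toVertex M'.toVertex ≤ n :=
      ih (sup_le hML (hϖL n _)) le_sup_right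
    have hMM' : M.1 ≤ M'.1 := le_sup_left
    have hϖ1 : ∀ S : Submodule O (Fin (d + 1) → K), ϖ • S ≤ S := fun S => by
      rw [← pow_one ϖ]; exact hϖL 1 S
    have hϖM' : ϖ • M'.1 ≤ M.1 := by
      rw [hM', Submodule.smul_sup', smul_smul, ← pow_succ']
      exact sup_le (hϖ1 _) hLM
    have h2 : combDist ϖ M'.toVertex M.toVertex ≤ 1 := by
      by_cases heq : M'.toVertex = M.toVertex
      · simp [combDist, heq]
      · have hadj : (skeletonGraph K d ϖ).Adj M'.toVertex M.toVertex := by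
          refine ⟨heq, ?_⟩
          rw [← Set.image_pair]
          refine isSimplex_image hϖ (Set.toFinite _) (Set.insert_nonempty _ _) ?_ ?_
          · rintro A (rfl | rfl) B (rfl | rfl)
            exacts [Or.inl le_rfl, Or.inr hMM', Or.inl hMM', Or.inl le_rfl]
          · rintro A (rfl | rfl) B (rfl | rfl)
            exacts [hϖ1 _, hϖM', (hϖ1 _).trans hMM', hϖ1 _]
        exact hadj.toWalk.edist_le.trans (by simp)
    calc combDist ϖ L.toVertex M.toVertex
        ≤ combDist ϖ L.toVertex M'.toVertex + combDist ϖ M'.toVertex M.toVertex :=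
          SimpleGraph.edist_triangle
      _ ≤ n + 1 := add_le_add h1 h2
      _ = ((n + 1 : ℕ) : ℕ∞) := by push_cast; rfl

lemma logOsc_of_isSimplex (hϖ : Irreducible ϖ) {τ : Set (Vertex O K d)} (hτ : IsSimplex ϖ τ)
    {s t : Vertex O K d} (hs : s ∈ τ) (ht : t ∈ τ) :
    LogOsc (latticeNorm s.rep) (latticeNorm t.rep) 1 := by
  obtain ⟨L, hL, hc⟩ := hτ.exists_logClose hϖ
  obtain ⟨k, hk⟩ := exists_latticeNorm_eq_exp_mul ((hL s hs).trans s.toVertex_rep.symm)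
  obtain ⟨l, hl⟩ := exists_latticeNorm_eq_exp_mul ((hL t ht).trans t.toVertex_rep.symm)
  intro v w hv hw
  simp only [hk, hl]
  rw [Real.log_mul (Real.exp_pos _).ne' ((isUltraNorm_latticeNorm _).pos v hv).ne',
    Real.log_mul (Real.exp_pos _).ne' ((isUltraNorm_latticeNorm _).pos v hv).ne',
    Real.log_mul (Real.exp_pos _).ne' ((isUltraNorm_latticeNorm _).pos w hw).ne',
    Real.log_mul (Real.exp_pos _).ne' ((isUltraNorm_latticeNorm _).pos w hw).ne',
    log_latticeNorm _ hv, log_latticeNorm _ hv, log_latticeNorm _ hw, log_latticeNorm _ hw]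
  have h : latticeLog (L s) v - latticeLog (L t) v ≤
      latticeLog (L s) w - latticeLog (L t) w + 1 := by
    rcases hc s hs t ht with h | h
    · have h1 := h v hv; have h2 := h w hw; omega
    · have h1 := h v hv; have h2 := h w hw; omega
  have h' : ((latticeLog (L s) v - latticeLog (L t) v : ℤ) : ℝ) ≤
      ((latticeLog (L s) w - latticeLog (L t) w + 1 : ℤ) : ℝ) := Int.cast_le.2 h
  push_cast at h'
  linarith

lemma logOsc_of_combDist_le (hϖ : Irreducible ϖ) {s t : Vertex O K d} {n : ℕ}
    (h : combDist ϖ s t ≤ n) : LogOsc (latticeNorm s.rep) (latticeNorm t.rep) n := by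
  have hwalk : ∀ {s t : Vertex O K d} (p : (skeletonGraph K d ϖ).Walk s t),
      LogOsc (latticeNorm s.rep) (latticeNorm t.rep) p.length := by
    intro s t p
    induction p with
    | nil => simpa using logOsc_self _
    | cons hadj p ih =>
      have := (logOsc_of_isSimplex hϖ hadj.2 (Set.mem_insert _ _)
        (Set.mem_insert_of_mem _ rfl)).trans ih
      rw [SimpleGraph.Walk.length_cons]
      exact this.mono (by push_cast; linarith)
  obtain ⟨p, hp⟩ := SimpleGraph.exists_walk_of_edist_ne_top
    (ne_top_of_le_ne_top (ENat.natCast_ne_top n) h)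
  refine (hwalk p).mono (Nat.cast_le.2 ?_)
  have : (p.length : ℕ∞) ≤ n := hp.trans_le h
  exact_mod_cast this

lemma logOsc_of_mem_closedStar (hϖ : Irreducible ϖ) {x : Realization K d ϖ} {s : Vertex O K d}
    (hx : x ∈ closedStar ϖ s) : LogOsc (pointNorm x) (latticeNorm s.rep) 1 := by
  simp only [closedStar, Set.mem_iUnion] at hx
  obtain ⟨τ, ⟨hτ, hs⟩, hsub⟩ := hx
  intro v w hv hw
  rw [log_pointNorm x hv, log_pointNorm x hw, ← one_mul (Real.log (latticeNorm s.rep v)),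
    ← one_mul (Real.log (latticeNorm s.rep w)), ← x.sum_weight, Finset.sum_mul, Finset.sum_mul,
    ← Finset.sum_sub_distrib, ← Finset.sum_sub_distrib, ← Finset.sum_add_distrib]
  refine Finset.sum_le_sum fun t ht => ?_
  have := mul_le_mul_of_nonneg_left (logOsc_of_isSimplex hϖ hτ (hsub ht) hs v w hv hw)
    (x.nonneg t)
  linarith

lemma logOsc_of_mem_ball (hϖ : Irreducible ϖ) {n : ℕ} {x : Realization K d ϖ}
    (hx : x ∈ ball K d ϖ n) :
    LogOsc (pointNorm x) (latticeNorm (standardVertex O K d).rep) n := by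
  rcases n with _ | n
  · have hsub : ∀ s ∈ x.weight.support, s = standardVertex O K d := fun s hs => hx hs
    have : ∀ v, v ≠ 0 → Real.log (pointNorm x v) =
        Real.log (latticeNorm (standardVertex O K d).rep v) := fun v hv => by
      rw [log_pointNorm x hv, ← one_mul (Real.log (latticeNorm (standardVertex O K d).rep v)),
        ← x.sum_weight, Finset.sum_mul]
      exact Finset.sum_congr rfl fun s hs => by rw [hsub s hs]
    intro v w hv hw
    simp [this v hv, this w hw]
  · simp only [ball, Set.mem_iUnion] at hx
    obtain ⟨s, hs, hx⟩ := hx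
    have := (logOsc_of_mem_closedStar hϖ hx).trans (logOsc_of_combDist_le hϖ hs).symm
    exact this.mono (by push_cast; linarith)

/-- Each vertex of the support of `x` has a representative that is a ball for the norm of `x`, of
radius in a given fundamental domain. -/
lemma exists_rep_of_mem_support (hϖ : Irreducible ϖ) (x : Realization K d ϖ) (m : ℝ)
    {s : Vertex O K d} (hs : s ∈ x.weight.support) :
    ∃ (M : Lattice O K d) (a : ℝ), 0 ≤ a ∧ a < 1 ∧ M.toVertex = s ∧
      ∀ v, v ≠ 0 → (v ∈ M.1 ↔ Real.log (pointNorm x v) ≤ m - a) := by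
  obtain ⟨M, r, hr, rfl, hM⟩ := exists_ball_of_mem_support hϖ x hs
  have hϖ' := algebraMap_uniformizer_ne_zero (K := K) hϖ
  -- Scaling by ϖ^j shifts the log radius from log r to log r - j = m - a, with `a` in [0, 1).
  set j : ℤ := ⌈Real.log r - m⌉ with hj
  have hc : algebraMap O K ϖ ^ j ≠ 0 := zpow_ne_zero _ hϖ'
  refine ⟨M.smul _ hc, j - (Real.log r - m), sub_nonneg.2 (Int.le_ceil _), ?_,
    M.toVertex_smul _ hc, fun v hv => ?_⟩
  · have := Int.ceil_lt_add_one (Real.log r - m)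
    linarith
  · change v ∈ (algebraMap O K ϖ ^ j) • M.1 ↔ _
    have hN := isUltraNorm_pointNorm hϖ x
    have hv' := hN.pos v hv
    rw [mem_smul_iff hc, hM, hN.smul, ← zpow_neg, dvrAbv_uniformizer_zpow hϖ,
      ← Real.log_le_log_iff (mul_pos (Real.exp_pos _) hv') hr,
      Real.log_mul (Real.exp_pos _).ne' hv'.ne', Real.log_exp]
    push_cast
    constructor <;> intro h <;> linarith

/-- The ball of radius `exp r` of an ultrametric norm. -/
def normBall {N : (Fin (d + 1) → K) → ℝ} (hN : IsUltraNorm (dvrAbv O K) N) (r : ℝ) :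
    Submodule O (Fin (d + 1) → K) where
  carrier := {v | N v ≤ Real.exp r}
  add_mem' hv hw := (hN.add_le _ _).trans (max_le hv hw)
  zero_mem' := hN.map_zero.trans_le (Real.exp_pos _).le
  smul_mem' a v hv := by
    change N (a • v) ≤ _
    rw [← algebraMap_smul K a v, hN.smul]
    exact (mul_le_of_le_one_left (hN.nonneg v) (dvrAbv_algebraMap_le_one a)).trans hv

lemma mem_normBall {N : (Fin (d + 1) → K) → ℝ} (hN : IsUltraNorm (dvrAbv O K) N) {r : ℝ}
    {v : Fin (d + 1) → K} (hv : v ≠ 0) : v ∈ normBall hN r ↔ Real.log (N v) ≤ r :=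
  (Real.log_le_iff_le_exp (hN.pos v hv)).symm

end Lattices

/-! ### Balls as sublevel sets of the oscillation, and conclusion -/

section Ball

variable {O K : Type*} [CommRing O] [IsDomain O] [IsDiscreteValuationRing O] [Field K] [Algebra O K]
  [IsFractionRing O K] {d : ℕ} {ϖ : O}

lemma LogOsc.exists_bounds {V : Type*} [Zero V] [Nontrivial V] {N M : V → ℝ} {a : ℝ}
    (h : LogOsc N M a) : ∃ m : ℝ, ∀ v, v ≠ 0 →
      Real.log (M v) + m ≤ Real.log (N v) ∧ Real.log (N v) ≤ Real.log (M v) + m + a := by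
  obtain ⟨v₀, hv₀⟩ := exists_ne (0 : V)
  have : Nonempty {v : V // v ≠ 0} := ⟨⟨v₀, hv₀⟩⟩
  let F : {v : V // v ≠ 0} → ℝ := fun v => Real.log (N v) - Real.log (M v)
  have hb : BddBelow (Set.range F) := by
    refine ⟨F ⟨v₀, hv₀⟩ - a, ?_⟩
    rintro _ ⟨w, rfl⟩
    have := h v₀ w hv₀ w.2
    simp only [F]
    linarith
  refine ⟨⨅ v, F v, fun v hv => ⟨?_, ?_⟩⟩
  · have : ⨅ v, F v ≤ Real.log (N v) - Real.log (M v) := ciInf_le hb ⟨v, hv⟩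
    linarith
  · have : Real.log (N v) - Real.log (M v) - a ≤ ⨅ v, F v := le_ciInf fun w => by
      have := h v w hv w.2
      simp only [F]
      linarith
    linarith

lemma mem_ball_of_logOsc (hϖ : Irreducible ϖ) {n : ℕ} {x : Realization K d ϖ}
    (h : LogOsc (pointNorm x) (latticeNorm (standardVertex O K d).rep) n) :
    x ∈ ball K d ϖ n := by
  classical
  set L₀ := (standardVertex O K d).rep with hL₀
  have hL₀v : L₀.toVertex = standardVertex O K d := Vertex.toVertex_rep _
  have hϖ' := algebraMap_uniformizer_ne_zero (K := K) hϖ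
  have hx := isUltraNorm_pointNorm hϖ x
  obtain ⟨m, hm⟩ := h.exists_bounds
  have : Nonempty (Lattice O K d) := ⟨L₀⟩
  choose! M a ha0 ha1 hM hmem using fun s hs => exists_rep_of_mem_support hϖ x m (s := s) hs
  have hlow : ∀ v, v ≠ 0 → (latticeLog L₀ v : ℝ) + m ≤ Real.log (pointNorm x v) := fun v hv => by
    rw [← log_latticeNorm L₀ hv]; exact (hm v hv).1
  have hup : ∀ v, v ≠ 0 → Real.log (pointNorm x v) ≤ latticeLog L₀ v + m + n := fun v hv => by
    rw [← log_latticeNorm L₀ hv]; exact (hm v hv).2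
  rcases n with _ | n
  · intro s hs
    rw [Set.mem_singleton_iff, ← hM s hs, ← hL₀v]
    refine (toVertex_eq_of_mem_iff (Real.exp_pos (-a s)) fun v => ?_).symm
    rcases eq_or_ne v 0 with rfl | hv
    · simp [(isUltraNorm_latticeNorm L₀).map_zero, (Real.exp_pos _).le]
    have h1 := hlow v hv
    have h2 := hup v hv
    rw [Nat.cast_zero, add_zero] at h2
    rw [hmem s hs v hv, latticeNorm_eq_exp L₀ hv, Real.exp_le_exp]
    constructor <;> intro h <;> linarith
  have hlogϖ : ∀ v, v ≠ 0 →
      Real.log (pointNorm x (algebraMap O K ϖ • v)) = Real.log (pointNorm x v) - 1 := by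
    intro v hv
    rw [hx.smul, dvrAbv_uniformizer hϖ, Real.log_mul (Real.exp_pos _).ne' (hx.pos v hv).ne',
      Real.log_exp]
    ring
  have hL₀ϖ : ∀ {v}, v ≠ 0 → ∀ k : ℤ,
      (v ∈ algebraMap O K ϖ ^ k • L₀.1 ↔ latticeLog L₀ v ≤ -k) := by
    intro v hv k
    rw [mem_smul_iff (zpow_ne_zero _ hϖ'), mem_iff_latticeNorm_le_one,
      (isUltraNorm_latticeNorm L₀).smul, ← zpow_neg, dvrAbv_uniformizer_zpow hϖ,
      latticeNorm_eq_exp L₀ hv, ← Real.exp_add, Real.exp_le_one_iff, ← Int.cast_neg,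
      ← Int.cast_add, Int.cast_nonpos]
    omega
  let L₁ : Lattice O K d := L₀.smul (algebraMap O K ϖ ^ (1 : ℤ)) (zpow_ne_zero _ hϖ')
  let L₂ : Lattice O K d := L₀.smul (algebraMap O K ϖ ^ (n + 1 : ℤ)) (zpow_ne_zero _ hϖ')
  have hL₁ : ∀ {v}, v ≠ 0 → (v ∈ L₁.1 ↔ latticeLog L₀ v ≤ -1) := fun hv => hL₀ϖ hv 1
  have hL₂ : ∀ {v}, v ≠ 0 → (v ∈ L₂.1 ↔ latticeLog L₀ v ≤ -(n + 1)) := fun hv => hL₀ϖ hv (n + 1)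
  have hS₂ : L₂.1 ≤ normBall hx m ⊓ L₁.1 := by
    rw [le_iff_forall_ne_zero]
    intro v hvL hv
    rw [hL₂ hv] at hvL
    refine ⟨(mem_normBall hx hv).2 ((hup v hv).trans ?_), (hL₁ hv).2 (by omega)⟩
    have : ((latticeLog L₀ v : ℤ) : ℝ) ≤ ((-(n + 1) : ℤ) : ℝ) := Int.cast_le.2 hvL
    push_cast at this ⊢
    linarith
  -- The centre of the star. Intersecting the ball of log radius `m` with ϖ L₀ gives ϖ^{n+1} L₀ ⊆ S
  -- ⊆ ϖ L₀, so this vertex is at distance at most n, one less than comparison with L₀ would give.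
  let S : Lattice O K d := Lattice.ofLeLe (normBall hx m ⊓ L₁.1) L₂ L₁ hS₂ inf_le_right
  have hS : ∀ {v}, v ≠ 0 →
      (v ∈ S.1 ↔ Real.log (pointNorm x v) ≤ m ∧ latticeLog L₀ v ≤ -1) := fun {v} hv => by
    change v ∈ normBall hx m ∧ v ∈ L₁.1 ↔ _
    rw [mem_normBall hx hv, hL₁ hv]
  simp only [ball, Set.mem_iUnion]
  refine ⟨S.toVertex, ?_, ?_⟩
  · change combDist ϖ _ _ ≤ _
    rw [← hL₀v, ← L₀.toVertex_smul _ (zpow_ne_zero (1 : ℤ) hϖ')]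
    refine combDist_toVertex_le hϖ n inf_le_right ?_
    have : ϖ ^ n • L₁.1 = L₂.1 := by
      rw [← algebraMap_smul_submodule]
      change algebraMap O K (ϖ ^ n) • (algebraMap O K ϖ ^ (1 : ℤ)) • L₀.1 =
        (algebraMap O K ϖ ^ (n + 1 : ℤ)) • L₀.1
      rw [smul_smul, map_pow, zpow_add₀ hϖ', zpow_natCast]
    exact this.trans_le hS₂
  · have hMM : ∀ s ∈ x.weight.support, ∀ t ∈ x.weight.support, a s ≤ a t →
        (M t).1 ≤ (M s).1 := fun s hs t ht hst => le_iff_forall_ne_zero.2 fun v hvM hv => by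
      rw [hmem t ht v hv] at hvM
      rw [hmem s hs v hv]
      linarith
    have hMϖM : ∀ s ∈ x.weight.support, ∀ t ∈ x.weight.support, ϖ • (M s).1 ≤ (M t).1 :=
      fun s hs t ht => uniformizer_smul_le_iff.2 fun v hvM hv => by
        rw [hmem s hs v hv] at hvM
        rw [hmem t ht _ (smul_ne_zero hϖ' hv), hlogϖ v hv]
        have := ha0 s hs; have := ha1 t ht
        linarith
    have hMϖS : ∀ s ∈ x.weight.support, ϖ • (M s).1 ≤ S.1 := fun s hs =>
      uniformizer_smul_le_iff.2 fun v hvM hv => by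
        rw [hmem s hs v hv] at hvM
        rw [hS (smul_ne_zero hϖ' hv), hlogϖ v hv, latticeLog_uniformizer_smul hϖ L₀ hv]
        have h1 := ha0 s hs
        have h2 := hlow v hv
        refine ⟨by linarith, ?_⟩
        have : (latticeLog L₀ v : ℝ) ≤ 0 := by linarith
        have : latticeLog L₀ v ≤ 0 := by exact_mod_cast this
        omega
    have hSϖM : ∀ s ∈ x.weight.support, ϖ • S.1 ≤ (M s).1 := fun s hs =>
      uniformizer_smul_le_iff.2 fun v hvS hv => by
        rw [hS hv] at hvS
        rw [hmem s hs _ (smul_ne_zero hϖ' hv), hlogϖ v hv]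
        have := ha1 s hs
        linarith [hvS.1]
    -- If `a s = 0` then `M s` is the whole ball of log radius `m`, which contains `S`. If `a s >
    -- 0`, its nonzero vectors have negative, hence at most -1, log norm for L₀, so `M s` lies in ϖ
    -- L₀ and in `S`.
    have hSM : ∀ s ∈ x.weight.support, S.1 ≤ (M s).1 ∨ (M s).1 ≤ S.1 := fun s hs => by
      rcases (ha0 s hs).eq_or_lt with h0 | h0
      · left
        rw [le_iff_forall_ne_zero]
        intro v hvS hv
        rw [hS hv] at hvS
        rw [hmem s hs v hv, ← h0, sub_zero]
        exact hvS.1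
      · right
        rw [le_iff_forall_ne_zero]
        intro v hvM hv
        rw [hmem s hs v hv] at hvM
        rw [hS hv]
        have h2 := hlow v hv
        refine ⟨by linarith, ?_⟩
        have : (latticeLog L₀ v : ℝ) < 0 := by linarith
        have : latticeLog L₀ v < 0 := by exact_mod_cast this
        omega
    have hSS : ϖ • S.1 ≤ S.1 := uniformizer_smul_le_iff.2 fun v hv _ => by
      rw [algebraMap_smul]; exact S.1.smul_mem _ hv
    have hsimp := isSimplex_image hϖ (S := insert S (M '' (x.weight.support : Set _)))
      (((Finset.finite_toSet _).image _).insert _) (Set.insert_nonempty _ _)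
      (by
        rintro _ (rfl | ⟨s, hs, rfl⟩) _ (rfl | ⟨t, ht, rfl⟩)
        · exact Or.inl le_rfl
        · exact hSM t ht
        · exact (hSM s hs).symm
        · exact (le_total (a t) (a s)).imp (hMM t ht s hs) (hMM s hs t ht))
      (by
        rintro _ (rfl | ⟨s, hs, rfl⟩) _ (rfl | ⟨t, ht, rfl⟩)
        exacts [hSS, hSϖM t ht, hMϖS s hs, hMϖM s hs t ht])
    simp only [closedStar, Set.mem_iUnion]
    refine ⟨_, ⟨hsimp, S, Set.mem_insert _ _, rfl⟩, fun s hs => ?_⟩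
    exact ⟨M s, Set.mem_insert_of_mem _ ⟨s, hs, rfl⟩, hM s hs⟩

/-- The balls of the building are the sublevel sets of the oscillation of the norms. -/
theorem mem_ball_iff (hϖ : Irreducible ϖ) {n : ℕ} {x : Realization K d ϖ} :
    x ∈ ball K d ϖ n ↔ LogOsc (pointNorm x) (latticeNorm (standardVertex O K d).rep) n :=
  ⟨logOsc_of_mem_ball hϖ, mem_ball_of_logOsc hϖ⟩

theorem isGeodesicallyConvex_ball (hϖ : Irreducible ϖ) (n : ℕ) :
    IsGeodesicallyConvex ϖ hϖ (ball K d ϖ n) := by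
  intro x hx y hy γ ⟨h0, h1, hγ⟩ t ht
  rw [mem_ball_iff hϖ] at hx hy ⊢
  obtain ⟨f, hfx, hfy⟩ := exists_common_apartment hϖ x y
  have hxz := hγ 0 (Set.left_mem_Icc.2 zero_le_one) t ht
  have hzy := hγ t ht 1 (Set.right_mem_Icc.2 zero_le_one)
  rw [h0, zero_sub, abs_neg, abs_of_nonneg ht.1] at hxz
  rw [h1, abs_sub_comm, abs_of_nonneg (sub_nonneg.2 ht.2)] at hzy
  obtain ⟨hfz, k, hk⟩ := splits_of_euclDist_eq hϖ hxz hzy hfx hfy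
  exact LogOsc.convex (isUltraNorm_pointNorm hϖ x) (isUltraNorm_pointNorm hϖ y)
    (isUltraNorm_pointNorm hϖ _) (isUltraNorm_latticeNorm _) hfx hfy hfz ht hk hx hy

end Ball

end

end BruhatTits

theorem mainTheorem8 {O K : Type*} [CommRing O] [IsDomain O] [IsDiscreteValuationRing O]
    [IsAdicComplete (IsLocalRing.maximalIdeal O) O] [Field K] [CharZero K] [Algebra O K]
    [IsFractionRing O K] (p : ℕ) [Fact p.Prime] [CharP (IsLocalRing.ResidueField O) p]
    [PerfectField (IsLocalRing.ResidueField O)]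
    (ϖ : O) (hϖ : Irreducible ϖ) (d n : ℕ) :
    BruhatTits.IsGeodesicallyConvex ϖ hϖ (BruhatTits.ball K d ϖ n) :=
  BruhatTits.isGeodesicallyConvex_ball hϖ n
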